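/- For a metric space $(\Omega,\rho)$ with its Borel $\sigma$-algebra, $\beta\in(0,1]$ and $f:\Omega\to[0,1]$, let $\Lambda_f^\beta(x)=\sup_{y\ne x}\frac{|f(x)-f(y)|}{\rho(x,y)^\beta}$, and for a probability measure $\mu$ on $\Omega$ let $\overline{\mathrm{H\ddot ol}}^\beta_L(\Omega,\mu)=\{f:\Omega\to[0,1] : \mathbb{E}_{X\sim\mu}[\Lambda^\beta_f(X)]\le L\}$. For a probability measure $\mathcal D$ on $\Omega\times[0,1]$ with marginal $\mu$ on $\Omega$ let $L_{\mathcal D}(f)=\mathbb{E}_{(X,Y)\sim\mathcal D}|f(X)-Y|$; $\mathcal D$ is realizable by a class $\mathcal F$ if $L_{\mathcal D}(f^*)=0$ for some measurable $f^*\in\mathcal F$. Let $\mathcal N_\Omega(r)$ be the least number of closed balls of radius $r$ that cover $\Omega$. For a finite non-empty $A\subset\Omega$ and $g:A\to[0,1]$, the $\beta$-pointwise minimum slope extension ($\beta$-PMSE) $F:\Omega\to[0,1]$ of $g$ is defined as follows. For $u,v\in A$ put $R_x(u,v)=\frac{g(v)-g(u)}{\rho(x,v)^\beta+\rho(x,u)^\beta}$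 and $F_x(u,v)=g(u)+R_x(u,v)\rho(x,u)^\beta$. If $g$ is not constant, $F(x)$ is the limit, as $\eta\to0^+$, of the values $F_x(u,v)$ over all pairs with $R_x(u,v)>\sup_{A\times A}R_x-\eta$; if $g$ is constant, $F$ is that constant. Given a sample $S=(X_i,Y_i)_{i=1}^n$ and $\gamma\in(0,1]$, the trim–net–extend rule with parameter $\gamma$ discards $\lfloor\gamma n\rfloor$ sample points whose slopes $\sup_{X_j\ne X_i}|Y_i-Y_j|/\rho(X_i,X_j)^\beta$ are largest, takes a $\gamma^{1/\beta}$-net $A$ (a $\gamma^{1/\beta}$-packing and $\gamma^{1/\beta}$-cover) of the remaining points, and outputs the $\beta$-PMSE extension to $\Omega$ of the labels on $A$ (the constant $1/2$ if no point remains). Ties and the net are chosen by the algorithm. **Theorem.** There are a learning algorithm $\mathcal A$, a polynomial $p$, a function $\gamma(\varepsilon,L)$ and universal constants $C,k$ such that the following holds for every metric space $(\Omega,\rho)$, every $\beta\in(0,1]$ and all $0<\varepsilon<\min(1,L)$, with $\gamma=\gamma(\varepsilon,L)\in(0,1]$. 1. $\mathcal A$ is a program of a real random-access machine (unit-cost exact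 arithmetic, comparisons and powers of real numbers) that reads $\beta,L,\varepsilon$, the labels and the distances between points. On every sample $S$ of every size $n$, $\mathcal A$ constructs a measurable hypothesis $f=\mathcal A(S):\Omega\to[0,1]$: training on $S$ takes at most $p(n)$ steps, after which $f(x)$ is computed at any query point $x\in\Omega$ in at most $p(n)$ steps. The hypothesis $f$ is an output of the trim–net–extend rule with parameter $\gamma$ on $S$. 2. For $\delta\in(0,1)$ put $$M=\frac{\mathcal N_\Omega\!\left(\left(\frac{\varepsilon}{256L\log(1/\varepsilon)}\right)^{1/\beta}\right)+\log(1/\delta)}{\varepsilon}.$$ If this covering number is finite, there is an $N\le C\,M\log^k(e+M)$ (that is, $N=\widetilde O(M)$), depending only on $\Omega,\beta,L,\varepsilon,\delta$, such that for every $\mathcal D$ realizable by $\overline{\mathrm{H\ddot ol}}^\beta_L(\Omega,\mu)$ and every $n\ge N$, with probability at least $1-\delta$ over $S\sim\mathcal D^n$, the hypothesis $f=\mathcal A(S)$ satisfies $L_{\mathcal D}(f)\le\varepsilon$. -/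

import Mathlib

open MeasureTheory Filter Topology
open scoped ENNReal unitInterval

/-! ### Average Hölder smoothness, risk and realizability -/

section Smoothness

variable {Ω : Type*} [MetricSpace Ω]

/-- The `β`-slope of `f` at `x`: the supremum over `y ≠ x` of `|f x - f y| / ρ(x, y) ^ β`,
as an extended nonnegative number. -/
noncomputable def slopeAt (β : ℝ) (f : Ω → ℝ) (x : Ω) : ℝ≥0∞ :=
  ⨆ (y : Ω) (_ : y ≠ x), ENNReal.ofReal (|f x - f y| / dist x y ^ β)

/-- The average Hölder class: functions `Ω → [0,1]` whose mean `β`-slope with respect to `μ` is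
at most `L`. -/
def avgHolder [MeasurableSpace Ω] (β L : ℝ) (μ : Measure Ω) : Set (Ω → ℝ) :=
  {f | (∀ x, f x ∈ Set.Icc (0 : ℝ) 1) ∧ ∫⁻ x, slopeAt β f x ∂μ ≤ ENNReal.ofReal L}

/-- The `L₁` risk `E |f(X) - Y|` for `(X, Y) ∼ D`, where `D` is a measure on `Ω × [0,1]`. -/
noncomputable def risk {Ω : Type*} [MeasurableSpace Ω] (D : Measure (Ω × I)) (f : Ω → ℝ) : ℝ≥0∞ :=
  ∫⁻ p, ENNReal.ofReal |f p.1 - (p.2 : ℝ)| ∂D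

/-- `D` is realizable by the class `F`: some (measurable) member of `F` has zero risk. -/
def Realizable {Ω : Type*} [MeasurableSpace Ω] (D : Measure (Ω × I)) (F : Set (Ω → ℝ)) : Prop :=
  ∃ f ∈ F, Measurable f ∧ risk D f = 0

end Smoothness

/-! ### The pointwise minimum slope extension -/

namespace PMSE

variable {Ω : Type*} [MetricSpace Ω]

/-- `R_x(u, v) = (g v - g u) / (ρ(x, v) ^ β + ρ(x, u) ^ β)`. -/
noncomputable def ratio (β : ℝ) (g : Ω → ℝ) (x u v : Ω) : ℝ :=
  (g v - g u) / (dist x v ^ β + dist x u ^ β)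

/-- `F_x(u, v) = g u + R_x(u, v) ρ(x, u) ^ β`. -/
noncomputable def interp (β : ℝ) (g : Ω → ℝ) (x u v : Ω) : ℝ :=
  g u + ratio β g x u v * dist x u ^ β

/-- `R*_x`, the supremum of `R_x(u, v)` over `u, v ∈ A`. -/
noncomputable def maxRatio (β : ℝ) (A : Set Ω) (g : Ω → ℝ) (x : Ω) : ℝ :=
  ⨆ p : A × A, ratio β g x p.1 p.2

/-- `Φ_x(η)`, the values `F_x(u, v)` over the pairs of points of `A` with
`R_x(u, v) > R*_x - η`. -/
def nearValues (β : ℝ) (A : Set Ω) (g : Ω → ℝ) (x : Ω) (η : ℝ) : Set ℝ :=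
  {z | ∃ u ∈ A, ∃ v ∈ A, maxRatio β A g x - η < ratio β g x u v ∧ z = interp β g x u v}

/-- `F` is the `β`-pointwise minimum slope extension of `g|_A` to `Ω`: at every `x`, the sets
`Φ_x(η)` shrink to the point `F x` as `η → 0⁺`; in the degenerate case that `g` is constant
on `A`, `F` is that constant. -/
def IsExtension (β : ℝ) (A : Set Ω) (g F : Ω → ℝ) : Prop :=
  ∀ x, ((∃ u ∈ A, ∃ v ∈ A, g u ≠ g v) →
      Tendsto (nearValues β A g x) (𝓝[>] 0) (𝓝 (F x)).smallSets) ∧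
    ((∀ u ∈ A, ∀ v ∈ A, g u = g v) → ∀ u ∈ A, F x = g u)

end PMSE

/-! ### The learning rule: trim, take a net, extend -/

section Rule

variable {Ω : Type*} [MetricSpace Ω]

/-- The slope of the `i`-th sample point relative to the sample, for the labels of the sample. -/
noncomputable def sampleSlope (β : ℝ) {n : ℕ} (S : Fin n → Ω × I) (i : Fin n) : ℝ :=
  ⨆ j : {j : Fin n // (S j).1 ≠ (S i).1},
    |((S i).2 : ℝ) - (S j).2| / dist (S i).1 (S j).1 ^ β

/-- `T` consists of `⌊γ n⌋` sample points of largest slope (ties broken arbitrarily). -/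
def IsTrimmed (β γ : ℝ) {n : ℕ} (S : Fin n → Ω × I) (T : Finset (Fin n)) : Prop :=
  T.card = ⌊γ * n⌋₊ ∧ ∀ i ∈ T, ∀ j ∉ T, sampleSlope β S j ≤ sampleSlope β S i

/-- The sample points with index in `A` form a `t`-net (a `t`-packing and a `t`-cover) of those
with index in `B`. -/
def IsSampleNet (t : ℝ) {n : ℕ} (S : Fin n → Ω × I) (B A : Finset (Fin n)) : Prop :=
  A ⊆ B ∧ (∀ i ∈ A, ∀ j ∈ A, i ≠ j → t ≤ dist (S i).1 (S j).1) ∧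
    ∀ i ∈ B, ∃ j ∈ A, dist (S i).1 (S j).1 ≤ t

/-- `f` results from the sample `S` by discarding `⌊γ n⌋` points of largest slope, taking a
`γ ^ (1 / β)`-net of the remaining points and applying the `β`-PMSE extension to the labels on
the net. If no point remains, `f` is the constant `1 / 2`. -/
def IsTrimNetExtension (β γ : ℝ) {n : ℕ} (S : Fin n → Ω × I) (f : Ω → ℝ) : Prop :=
  ∃ T A : Finset (Fin n), IsTrimmed β γ S T ∧ IsSampleNet (γ ^ (1 / β)) S Tᶜ A ∧
    (A.Nonempty → ∃ g : Ω → ℝ, (∀ i ∈ A, g (S i).1 = (S i).2) ∧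
      PMSE.IsExtension β {x | ∃ i ∈ A, x = (S i).1} g f) ∧
    (A = ∅ → ∀ x, f x = 1 / 2)

end Rule

/-! ### A real random-access machine with a step count

Programs of a small imperative language act on index registers (natural numbers, which can be
added and subtracted) and on arrays of real cells, addressed through index registers.
The points of the metric space are accessible only through their pairwise distances. Exact real
arithmetic, powers with real exponents and comparisons have unit cost. -/

namespace RealRAM

/-- What a program may read: labels of sample points, and distances between points, the points
being referred to by numbers. -/
structure Env where
  label : ℕ → ℝ
  distance : ℕ → ℕ → ℝ

/-- The memory: `idx r` is index register `r`, and `cell a i` is entry `i` of array `a`. -/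
structure Mem where
  idx : ℕ → ℕ
  cell : ℕ → ℕ → ℝ

/-- Index expressions. -/
inductive IExp where
  | lit (c : ℕ)
  | reg (r : ℕ)
  | add (a b : IExp)
  | sub (a b : IExp)

namespace IExp

/-- The value (subtraction is truncated). -/
def eval (m : Mem) : IExp → ℕ
  | lit c => c
  | reg r => m.idx r
  | add a b => a.eval m + b.eval m
  | sub a b => a.eval m - b.eval m

/-- The number of elementary operations. -/
def cost : IExp → ℕ
  | lit _ => 1
  | reg _ => 1
  | add a b => a.cost + b.cost + 1
  | sub a b => a.cost + b.cost + 1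

end IExp

/-- Real expressions. -/
inductive RExp where
  | ofIdx (i : IExp)
  | cell (a : ℕ) (i : IExp)
  | label (i : IExp)
  | distance (i j : IExp)
  | add (a b : RExp)
  | sub (a b : RExp)
  | mul (a b : RExp)
  | div (a b : RExp)
  | pow (a b : RExp)

namespace RExp

/-- The value. -/
noncomputable def eval (e : Env) (m : Mem) : RExp → ℝ
  | ofIdx i => (i.eval m : ℝ)
  | cell a i => m.cell a (i.eval m)
  | label i => e.label (i.eval m)
  | distance i j => e.distance (i.eval m) (j.eval m)
  | add a b => a.eval e m + b.eval e m
  | sub a b => a.eval e m - b.eval e m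
  | mul a b => a.eval e m * b.eval e m
  | div a b => a.eval e m / b.eval e m
  | pow a b => a.eval e m ^ b.eval e m

/-- The number of elementary operations. -/
def cost : RExp → ℕ
  | ofIdx i => i.cost + 1
  | cell _ i => i.cost + 1
  | label i => i.cost + 1
  | distance i j => i.cost + j.cost + 1
  | add a b => a.cost + b.cost + 1
  | sub a b => a.cost + b.cost + 1
  | mul a b => a.cost + b.cost + 1
  | div a b => a.cost + b.cost + 1
  | pow a b => a.cost + b.cost + 1

end RExp

/-- Tests. -/
inductive BExp where
  | leIdx (a b : IExp)
  | leReal (a b : RExp)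
  | not (b : BExp)
  | and (b c : BExp)

namespace BExp

/-- The truth value. -/
def holds (e : Env) (m : Mem) : BExp → Prop
  | leIdx a b => a.eval m ≤ b.eval m
  | leReal a b => a.eval e m ≤ b.eval e m
  | not b => ¬ b.holds e m
  | and b c => b.holds e m ∧ c.holds e m

/-- The number of elementary operations. -/
def cost : BExp → ℕ
  | leIdx a b => a.cost + b.cost + 1
  | leReal a b => a.cost + b.cost + 1
  | not b => b.cost + 1
  | and b c => b.cost + c.cost + 1

end BExp

/-- Programs. -/
inductive Prog where
  | skip
  | setIdx (r : ℕ) (i : IExp)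
  | setCell (a : ℕ) (i : IExp) (x : RExp)
  | seq (c d : Prog)
  | branch (b : BExp) (c d : Prog)
  | loop (b : BExp) (c : Prog)

/-- `Run e c m t m'`: in the environment `e`, the program `c` started in memory `m` halts after
exactly `t` steps in memory `m'`. The program `loop b c` repeats `c` while `b` holds. -/
inductive Run (e : Env) : Prog → Mem → ℕ → Mem → Prop where
  | skip (m : Mem) : Run e Prog.skip m 1 m
  | setIdx (r : ℕ) (i : IExp) (m : Mem) :
      Run e (Prog.setIdx r i) m (i.cost + 1)
        { m with idx := Function.update m.idx r (i.eval m) }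
  | setCell (a : ℕ) (i : IExp) (x : RExp) (m : Mem) :
      Run e (Prog.setCell a i x) m (i.cost + x.cost + 1)
        { m with cell := Function.update m.cell a
                    (Function.update (m.cell a) (i.eval m) (x.eval e m)) }
  | seq {c d : Prog} {m m₁ m₂ : Mem} {t₁ t₂ : ℕ} :
      Run e c m t₁ m₁ → Run e d m₁ t₂ m₂ → Run e (Prog.seq c d) m (t₁ + t₂) m₂
  | branchTrue {b : BExp} {c d : Prog} {m m' : Mem} {t : ℕ} :
      b.holds e m → Run e c m t m' → Run e (Prog.branch b c d) m (b.cost + t) m'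
  | branchFalse {b : BExp} {c d : Prog} {m m' : Mem} {t : ℕ} :
      ¬ b.holds e m → Run e d m t m' → Run e (Prog.branch b c d) m (b.cost + t) m'
  | loopStop {b : BExp} {c : Prog} {m : Mem} :
      ¬ b.holds e m → Run e (Prog.loop b c) m b.cost m
  | loopStep {b : BExp} {c : Prog} {m m₁ m₂ : Mem} {t₁ t₂ : ℕ} :
      b.holds e m → Run e c m t₁ m₁ → Run e (Prog.loop b c) m₁ t₂ m₂ →
      Run e (Prog.loop b c) m (b.cost + t₁ + t₂) m₂

/-- The point referred to by the number `k`: the `k`-th sample point if `k < n`, and the query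
point, if there is one, if `k = n`. -/
def pointAt {Ω : Type*} {n : ℕ} (S : Fin n → Ω × I) (q : Option Ω) (k : ℕ) : Option Ω :=
  if h : k < n then some (S ⟨k, h⟩).1 else if k = n then q else none

/-- The environment given by the sample `S` and the optional query point `q`; reading outside the
range gives `0`. -/
noncomputable def sampleEnv {Ω : Type*} [MetricSpace Ω] {n : ℕ} (S : Fin n → Ω × I)
    (q : Option Ω) : Env where
  label k := if h : k < n then ((S ⟨k, h⟩).2 : ℝ) else 0
  distance k l :=
    match pointAt S q k, pointAt S q l with
    | some x, some y => dist x y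
    | _, _ => 0

/-- The memory at the start: the sample size `n` in index register `0`, the parameters
`β, L, ε` in the first cells of array `0`, zero everywhere else. -/
def startMem (β L ε : ℝ) (n : ℕ) : Mem where
  idx r := if r = 0 then n else 0
  cell a i :=
    if a = 0 then (if i = 0 then β else if i = 1 then L else if i = 2 then ε else 0) else 0

/-- A learner: a program for training, which sees only the sample, and a program that evaluates
the constructed hypothesis at a query point, starting from the memory that training leaves. -/
structure Learner where
  train : Prog
  predict : Prog

/-- From the parameters `β, L, ε` and the sample `S`, the learner constructs the hypothesis `f`:
training takes at most `t` steps, after which the value of `f` at any query point is computed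
(into entry `0` of array `0`) in at most `t` steps. -/
def Learner.Constructs (𝒜 : Learner) {Ω : Type*} [MetricSpace Ω] (β L ε : ℝ) {n : ℕ}
    (S : Fin n → Ω × I) (f : Ω → ℝ) (t : ℕ) : Prop :=
  ∃ m : Mem, (∃ s ≤ t, Run (sampleEnv S none) 𝒜.train (startMem β L ε n) s m) ∧
    ∀ x : Ω, ∃ m' : Mem, (∃ s ≤ t, Run (sampleEnv S (some x)) 𝒜.predict m s m') ∧
      m'.cell 0 0 = f x

end RealRAM

/-! ### The sample complexity -/

/-- The quantity `(N_Ω((ε / (256 L log (1/ε))) ^ (1/β)) + log (1/δ)) / ε`, where `N_Ω(r)` is the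
least number of closed `r`-balls covering `Ω`. -/
noncomputable def complexityTerm (Ω : Type*) [MetricSpace Ω] (β L ε δ : ℝ) : ℝ :=
  ((Metric.coveringNumber ((ε / (256 * L * Real.log (1 / ε))) ^ (1 / β)).toNNReal
      (Set.univ : Set Ω)).toNat + Real.log (1 / δ)) / ε

/-!
# Learning average Hölder functions by trimming, taking a net and extending

For `ε ≥ 1 / 2` the trimming level is `1`, every point is discarded and the constant `1 / 2` has
risk at most `ε`. For `ε < 1 / 2` the level is `γ = ε² / (128 L)`. All that matters about this
choice is that `γ` is at most `ε / 16`, at most the scale `τ = 2 r ^ β`, where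
`r = (ε / (256 L log (1 / ε))) ^ (1 / β)` is the covering radius (`trimLevel_le_two_mul`), and that
it is computable without logarithms.

The risk bound needs no uniform convergence over a function class. Let `f` be the target and cut
`Ω` into `N_Ω(r)` measurable cells, which have `β`-diameter at most `τ` (`exists_cells`). The part
of a cell `C` where the slope of `f` is at most `s`, twice its average over `C`, has at least half
of the mass of `C` by Markov's inequality (`measure_le_two_mul_typicalPart`).

* Suppose that some untrimmed sample point `z` lies in this part of `C`. There is a net point `j` at
  `β`-distance at most `γ ≤ τ` from `z`; since all other net points have `β`-distance at least `γ`
  from `j`, the slope of the labels at `j` relative to the net is at most `3 s`. The PMSE extension does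
  not increase the slope at the points it extends from (`PMSE.abs_envelope_sub_le`), so it is within
  `8 s τ` of `f` on all of `C` (`PMSE.abs_envelope_sub_le_of_net`). Summed against the masses of the
  cells this contributes at most `16 τ L ≤ ε / 2` to the risk.
* The other cells have total mass at most `ε / 2` with high probability: otherwise a union of
  typical parts of mass at least `ε / 4` contains only trimmed points, at most `γ n ≤ ε n / 16` of
  them. A lower tail bound (`measureReal_card_le`) and a union bound over the `2 ^ N_Ω(r)` unions
  give probability at most `2 ^ N_Ω(r) exp (-n ε / 16)` (`measure_bad_sample_le`).

So `n ≥ 16 (N_Ω(r) + log (1 / δ)) / ε` sample points suffice, without logarithmic factors.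

The program trims by rank: a point is discarded when the number of points before it, in order of
decreasing slope with ties broken by index, is less than `⌊γ n⌋`. It then builds a net greedily. For
prediction it uses that the PMSE extension from a finite set is the lower envelope
`min_w (g w + R*_x ρ(x, w) ^ β)` (`PMSE.isExtension_envelope`). It is verified with a small calculus
of total correctness with time bounds (`RealRAM.Halts`).
-/

/-! ### Reasoning about programs of the real random-access machine -/

namespace RealRAM

/-- Total correctness with a time bound: from `m`, the program `c` halts within `t` steps in a
memory satisfying `Q`. -/
def Halts (e : Env) (c : Prog) (m : Mem) (t : ℕ) (Q : Mem → Prop) : Prop :=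
  ∃ s ≤ t, ∃ m', Run e c m s m' ∧ Q m'

/-- `for r = 0, …, q - 1 do body`, where `q` is the content of index register `q`. -/
def forTo (r q : ℕ) (body : Prog) : Prog :=
  .seq (.setIdx r (.lit 0))
    (.loop (.not (.leIdx (.reg q) (.reg r)))
      (.seq body (.setIdx r (.add (.reg r) (.lit 1)))))

section Rules

variable {e : Env} {c d : Prog} {m : Mem} {t t₁ t₂ : ℕ} {Q : Mem → Prop}

theorem Halts.skip (h : Q m) (ht : 1 ≤ t) : Halts e .skip m t Q :=
  ⟨1, ht, m, .skip m, h⟩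

theorem Halts.setIdx {r : ℕ} {i : IExp}
    (h : Q { m with idx := Function.update m.idx r (i.eval m) }) (ht : i.cost + 1 ≤ t) :
    Halts e (.setIdx r i) m t Q :=
  ⟨_, ht, _, .setIdx r i m, h⟩

theorem Halts.setCell {a : ℕ} {i : IExp} {x : RExp}
    (h : Q { m with cell := Function.update m.cell a
                      (Function.update (m.cell a) (i.eval m) (x.eval e m)) })
    (ht : i.cost + x.cost + 1 ≤ t) :
    Halts e (.setCell a i x) m t Q :=
  ⟨_, ht, _, .setCell a i x m, h⟩

theorem Halts.seq (t₁ t₂ : ℕ) (h : Halts e c m t₁ fun m' => Halts e d m' t₂ Q)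
    (ht : t₁ + t₂ ≤ t) : Halts e (.seq c d) m t Q := by
  obtain ⟨s₁, hs₁, m₁, hr₁, s₂, hs₂, m₂, hr₂, hQ⟩ := h
  exact ⟨s₁ + s₂, by omega, m₂, .seq hr₁ hr₂, hQ⟩

theorem Halts.branch {b : BExp} (t₁ : ℕ) (h : b.holds e m → Halts e c m t₁ Q)
    (h' : ¬ b.holds e m → Halts e d m t₁ Q) (ht : b.cost + t₁ ≤ t) :
    Halts e (.branch b c d) m t Q := by
  by_cases hb : b.holds e m
  · obtain ⟨s, hs, m', hr, hQ⟩ := h hb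
    exact ⟨_, by omega, m', .branchTrue hb hr, hQ⟩
  · obtain ⟨s, hs, m', hr, hQ⟩ := h' hb
    exact ⟨_, by omega, m', .branchFalse hb hr, hQ⟩

/-- The invariant rule for `forTo`; the invariant `J k` describes the memory before the pass with
counter `k`. -/
theorem Halts.forTo {r q N : ℕ} (J : ℕ → Mem → Prop) (t₁ : ℕ) (hrq : q ≠ r) (hN : m.idx q = N)
    (h0 : J 0 { m with idx := Function.update m.idx r 0 })
    (hstep : ∀ k < N, ∀ m₁ : Mem, J k m₁ → m₁.idx r = k → m₁.idx q = N →
      Halts e c m₁ t₁ fun m₂ => m₂.idx r = k ∧ m₂.idx q = N ∧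
        J (k + 1) { m₂ with idx := Function.update m₂.idx r (k + 1) })
    (hQ : ∀ m₁ : Mem, J N m₁ → Q m₁) (ht : N * (t₁ + 8) + 6 ≤ t) :
    Halts e (forTo r q c) m t Q := by
  -- induction on the number of remaining passes
  have key : ∀ d k : ℕ, k + d = N → ∀ m₁ : Mem, J k m₁ → m₁.idx r = k → m₁.idx q = N →
      Halts e (.loop (.not (.leIdx (.reg q) (.reg r)))
        (.seq c (.setIdx r (.add (.reg r) (.lit 1))))) m₁ (d * (t₁ + 8) + 4) Q := by
    intro d
    induction d with
    | zero =>
      intro k hk m₁ hJ hr hq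
      refine ⟨_, ?_, m₁, .loopStop ?_, hQ m₁ ?_⟩
      · simp [BExp.cost, IExp.cost]
      · simp only [BExp.holds, IExp.eval, not_not]; omega
      · rwa [← hk]
    | succ d ih =>
      intro k hk m₁ hJ hr hq
      obtain ⟨s, hs, m₂, hrun, hr₂, hq₂, hJ₂⟩ := hstep k (by omega) m₁ hJ hr hq
      obtain ⟨s', hs', m₃, hrun', hQ'⟩ := ih (k + 1) (by omega) _ hJ₂ (by simp)
        (by simp [Function.update_of_ne hrq, hq₂])
      have hinc : Run e (.setIdx r (.add (.reg r) (.lit 1))) m₂ 4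
          { m₂ with idx := Function.update m₂.idx r (k + 1) } := by
        have := Run.setIdx (e := e) r (.add (.reg r) (.lit 1)) m₂
        simpa [IExp.eval, IExp.cost, hr₂] using this
      refine ⟨_, ?_, m₃, .loopStep ?_ (.seq hrun hinc) hrun', hQ'⟩
      · simp only [BExp.cost, IExp.cost]; linarith
      · simp only [BExp.holds, IExp.eval]; omega
  refine Halts.seq 2 (N * (t₁ + 8) + 4) (Halts.setIdx ?_ (by simp [IExp.cost])) (by omega)
  exact key N 0 (by omega) _ h0 (by simp [IExp.eval]) (by simp [Function.update_of_ne hrq, hN])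

end Rules

end RealRAM

/-! ### The program -/

namespace RealRAM

/-- The quotient `|Y_i - Y_j| / ρ(X_i, X_j) ^ β` for `i, j` in registers `1, 2`; the absolute value
of a number is the power `1 / 2` of its square. -/
def quotExp : RExp :=
  .div (.pow (.mul (.sub (.label (.reg 1)) (.label (.reg 2)))
      (.sub (.label (.reg 1)) (.label (.reg 2)))) (.div (.ofIdx (.lit 1)) (.ofIdx (.lit 2))))
    (.pow (.distance (.reg 1) (.reg 2)) (.cell 0 (.lit 0)))

/-- Compute the trimming level into entry `0` of array `3` and the net scale into entry `1`. -/
def paramPass : Prog :=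
  .seq (.branch (.leReal (.div (.ofIdx (.lit 1)) (.ofIdx (.lit 2))) (.cell 0 (.lit 2)))
      (.setCell 3 (.lit 0) (.ofIdx (.lit 1)))
      (.setCell 3 (.lit 0) (.div (.mul (.cell 0 (.lit 2)) (.cell 0 (.lit 2)))
        (.mul (.ofIdx (.lit 128)) (.cell 0 (.lit 1))))))
    (.setCell 3 (.lit 1) (.pow (.cell 3 (.lit 0)) (.div (.ofIdx (.lit 1)) (.cell 0 (.lit 0)))))

/-- Compute the sample slopes into array `1`. -/
def slopePass : Prog :=
  forTo 1 0 (forTo 2 0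
    (.branch (.and (.not (.leReal (.distance (.reg 1) (.reg 2)) (.ofIdx (.lit 0))))
        (.not (.leReal quotExp (.cell 1 (.reg 1)))))
      (.setCell 1 (.reg 1) quotExp) .skip))

/-- The test that the sample point in register `2` is to be discarded before the one in
register `1`: it has a larger slope, or the same slope and a smaller index. -/
def beforeTest : BExp :=
  .and (.leReal (.cell 1 (.reg 1)) (.cell 1 (.reg 2)))
    (.not (.and (.leReal (.cell 1 (.reg 2)) (.cell 1 (.reg 1))) (.leIdx (.reg 1) (.reg 2))))

/-- Count in register `3` the points to be discarded before the point in register `1`. -/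
def rankPass : Prog :=
  .seq (.setIdx 3 (.lit 0))
    (forTo 2 0 (.branch beforeTest (.setIdx 3 (.add (.reg 3) (.lit 1))) .skip))

/-- Flag the points of the net by `1` in array `2`: a point enters the net if its rank is too large
for it to be discarded and no earlier point of the net is closer than the net scale. -/
def netPass : Prog :=
  forTo 1 0 (.seq rankPass (.seq
    (.branch (.leReal (.ofIdx (.add (.reg 3) (.lit 1))) (.mul (.cell 3 (.lit 0)) (.ofIdx (.reg 0))))
      .skip (.setCell 2 (.reg 1) (.ofIdx (.lit 1))))
    (forTo 2 1 (.branch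
      (.and (.leReal (.ofIdx (.lit 1)) (.cell 2 (.reg 2)))
        (.not (.leReal (.cell 3 (.lit 1)) (.distance (.reg 1) (.reg 2)))))
      (.setCell 2 (.reg 1) (.ofIdx (.lit 0))) .skip))))

/-- `R_x(u, v)` for the query point `x` and `u, v` in registers `1, 2`. -/
def ratioExp : RExp :=
  .div (.sub (.label (.reg 2)) (.label (.reg 1)))
    (.add (.pow (.distance (.reg 0) (.reg 2)) (.cell 0 (.lit 0)))
      (.pow (.distance (.reg 0) (.reg 1)) (.cell 0 (.lit 0))))

/-- Compute `R*_x` into entry `0` of array `4`. -/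
def ratioPass : Prog :=
  forTo 1 0 (forTo 2 0
    (.branch (.and (.leReal (.ofIdx (.lit 1)) (.cell 2 (.reg 1)))
        (.and (.leReal (.ofIdx (.lit 1)) (.cell 2 (.reg 2)))
          (.not (.leReal ratioExp (.cell 4 (.lit 0))))))
      (.setCell 4 (.lit 0) ratioExp) .skip))

/-- `g u + R*_x ρ(x, u) ^ β` for the query point `x` and `u` in register `1`. -/
def valueExp : RExp :=
  .add (.label (.reg 1)) (.mul (.cell 4 (.lit 0))
    (.pow (.distance (.reg 0) (.reg 1)) (.cell 0 (.lit 0))))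

/-- Compute the minimum of `2` and of all `g u + R*_x ρ(x, u) ^ β` into entry `1` of array `4`. -/
def valuePass : Prog :=
  .seq (.setCell 4 (.lit 1) (.ofIdx (.lit 2)))
    (forTo 1 0
      (.branch (.and (.leReal (.ofIdx (.lit 1)) (.cell 2 (.reg 1)))
          (.not (.leReal (.cell 4 (.lit 1)) valueExp)))
        (.setCell 4 (.lit 1) valueExp) .skip))

/-- The learner. A final minimum of `2` means that the net is empty. -/
def trimNetExtend : Learner where
  train := .seq paramPass (.seq slopePass netPass)
  predict := .seq ratioPass (.seq valuePass
    (.branch (.leReal (.ofIdx (.lit 2)) (.cell 4 (.lit 1)))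
      (.setCell 0 (.lit 0) (.div (.ofIdx (.lit 1)) (.ofIdx (.lit 2))))
      (.setCell 0 (.lit 0) (.cell 4 (.lit 1)))))

end RealRAM

/-- The trimming level of the learner. -/
noncomputable def trimLevel (ε L : ℝ) : ℝ :=
  if 1 / 2 ≤ ε then 1 else ε * ε / (128 * L)

/-! ### Correctness and running time of the program -/

namespace RealRAM

/-- The slopes `|Y_i - Y_j| / ρ(X_i, X_j) ^ β` over `j < k` with `X_j ≠ X_i`, together with `0`. -/
def slopeSet (e : Env) (β : ℝ) (i k : ℕ) : Set ℝ :=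
  insert 0 {z | ∃ j < k, 0 < e.distance i j ∧
    z = |e.label i - e.label j| / e.distance i j ^ β}

theorem mul_self_rpow_half (a : ℝ) : (a * a) ^ ((1 : ℝ) / 2) = |a| := by
  rw [← Real.sqrt_eq_rpow, Real.sqrt_mul_self_eq_abs]

theorem quotExp_eval (e : Env) (m : Mem) : quotExp.eval e m =
    |e.label (m.idx 1) - e.label (m.idx 2)| / e.distance (m.idx 1) (m.idx 2) ^ m.cell 0 0 := by
  simp only [quotExp, RExp.eval, IExp.eval, Nat.cast_one, Nat.cast_ofNat, mul_self_rpow_half]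

theorem isGreatest_of_insert {s s' : Set ℝ} {x v : ℝ} (h : IsGreatest s x) (hs : s' = insert v s)
    (hv : x ≤ v) : IsGreatest s' v := by
  have := h.insert v
  rwa [max_eq_left hv, ← hs] at this

theorem isGreatest_of_insert_le {s s' : Set ℝ} {x v : ℝ} (h : IsGreatest s x)
    (hs : s' = insert v s) (hv : v ≤ x) : IsGreatest s' x := by
  have := h.insert v
  rwa [max_eq_right hv, ← hs] at this

theorem slopeSet_succ_of_pos {e : Env} {β : ℝ} {i k : ℕ} (h : 0 < e.distance i k) :
    slopeSet e β i (k + 1) =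
      insert (|e.label i - e.label k| / e.distance i k ^ β) (slopeSet e β i k) := by
  ext z
  simp only [slopeSet, Set.mem_insert_iff, Set.mem_ofPred_eq, Nat.lt_succ_iff_lt_or_eq]
  constructor
  · rintro (h | ⟨j, hj | rfl, hd, rfl⟩)
    · exact .inr (.inl h)
    · exact .inr (.inr ⟨j, hj, hd, rfl⟩)
    · exact .inl rfl
  · rintro (rfl | h | ⟨j, hj, hd, rfl⟩)
    · exact .inr ⟨k, .inr rfl, h, rfl⟩
    · exact .inl h
    · exact .inr ⟨j, .inl hj, hd, rfl⟩

theorem slopeSet_succ_of_nonpos {e : Env} {β : ℝ} {i k : ℕ} (h : ¬ 0 < e.distance i k) :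
    slopeSet e β i (k + 1) = slopeSet e β i k := by
  ext z
  simp only [slopeSet, Set.mem_insert_iff, Set.mem_ofPred_eq, Nat.lt_succ_iff_lt_or_eq]
  constructor
  · rintro (h | ⟨j, hj | rfl, hd, rfl⟩)
    · exact .inl h
    · exact .inr ⟨j, hj, hd, rfl⟩
    · exact absurd hd h
  · rintro (h | ⟨j, hj, hd, rfl⟩)
    · exact .inl h
    · exact .inr ⟨j, .inl hj, hd, rfl⟩

theorem slopeSet_zero_isGreatest (e : Env) (β : ℝ) (i : ℕ) : IsGreatest (slopeSet e β i 0) 0 := by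
  simp [slopeSet]

/-- The part of the memory that the passes over the sample leave alone. -/
def Frame (n : ℕ) (p q : ℕ → ℝ) (m : Mem) : Prop :=
  m.idx 0 = n ∧ m.cell 0 = p ∧ m.cell 3 = q ∧ ∀ i, m.cell 4 i = 0

theorem slopePass_halts (e : Env) {n : ℕ} {p q : ℕ → ℝ} {m : Mem} (hm : Frame n p q m)
    (h1 : ∀ i, m.cell 1 i = 0) (h2 : ∀ i, m.cell 2 i = 0) :
    Halts e slopePass m (n * (n * 88 + 14) + 6) fun m' =>
      Frame n p q m' ∧ (∀ i, m'.cell 2 i = 0) ∧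
        ∀ i < n, IsGreatest (slopeSet e (p 0) i n) (m'.cell 1 i) := by
  obtain ⟨hn, hp, hq, h4⟩ := hm
  refine Halts.forTo (N := n) (fun k m' => Frame n p q m' ∧ (∀ i, m'.cell 2 i = 0) ∧
    (∀ i < k, IsGreatest (slopeSet e (p 0) i n) (m'.cell 1 i)) ∧ ∀ i ≥ k, m'.cell 1 i = 0)
    (n * (80 + 8) + 6) (by norm_num) hn ?_ ?_ ?_ (by linarith)
  · exact ⟨⟨by simpa using hn, hp, hq, h4⟩, h2, by simp, fun i _ => h1 i⟩
  · rintro k hk m₁ ⟨hF, h2, hG, hZ⟩ hk1 hk0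
    refine Halts.forTo (N := n) (fun l m' => m'.idx 1 = k ∧ Frame n p q m' ∧
      (∀ i, m'.cell 2 i = 0) ∧
      (∀ i < k, IsGreatest (slopeSet e (p 0) i n) (m'.cell 1 i)) ∧
      IsGreatest (slopeSet e (p 0) k l) (m'.cell 1 k) ∧ ∀ i > k, m'.cell 1 i = 0)
      80 (by norm_num) hk0 ?_ ?_ ?_ le_rfl
    · refine ⟨by simpa using hk1, ?_, h2, hG, ?_, fun i hi => hZ i (le_of_lt hi)⟩
      · simpa [Frame] using hF
      · simpa [hZ k le_rfl] using slopeSet_zero_isGreatest e (p 0) k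
    · rintro l hl m₂ ⟨h1, ⟨hF0, hFp, hFq, hF4⟩, h2, hG, hGk, hZ⟩ hl2 hl0
      have hquot : quotExp.eval e m₂ = |e.label k - e.label l| / e.distance k l ^ p 0 := by
        rw [quotExp_eval, h1, hl2, hFp]
      refine Halts.branch 35 ?_ ?_ (by simp [BExp.cost, RExp.cost, IExp.cost, quotExp])
      · intro hb
        simp only [BExp.holds, RExp.eval, hquot, IExp.eval, h1, hl2, not_le] at hb
        refine Halts.setCell ?_ (by simp [RExp.cost, IExp.cost, quotExp])
        simp only [hquot, IExp.eval, h1]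
        refine ⟨by simpa using hl2, hl0, ?_⟩
        refine ⟨by simpa using h1, ⟨?_, ?_, ?_, ?_⟩, ?_, ?_, ?_, ?_⟩
        · simpa using hF0
        · simpa using hFp
        · simpa using hFq
        · simpa using hF4
        · simpa using h2
        · intro i hi
          simpa [hi.ne] using hG i hi
        · have hd : 0 < e.distance k l := by simpa using hb.1
          simpa using isGreatest_of_insert hGk (slopeSet_succ_of_pos hd) hb.2.le
        · intro i hi
          have : i ≠ k := by omega
          simpa [this] using hZ i hi
      · intro hb
        simp only [BExp.holds, RExp.eval, hquot, IExp.eval, h1, hl2, not_le] at hb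
        refine Halts.skip ?_ (by norm_num)
        refine ⟨hl2, hl0, by simpa using h1, ⟨by simpa using hF0, hFp, hFq, hF4⟩, h2, hG, ?_, hZ⟩
        by_cases hd : 0 < e.distance k l
        · refine isGreatest_of_insert_le hGk (slopeSet_succ_of_pos hd) ?_
          by_contra hlt
          exact hb ⟨by simpa using hd, not_le.1 hlt⟩
        · rw [slopeSet_succ_of_nonpos hd]; exact hGk
    · rintro m₃ ⟨h1, hF, h2, hG, hGk, hZ⟩
      refine ⟨h1, hF.1, by simpa [Frame] using hF, h2, ?_, fun i hi => hZ i (by omega)⟩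
      intro i hi
      rcases Nat.lt_succ_iff_lt_or_eq.1 hi with hi | rfl
      · exact hG i hi
      · exact hGk
  · rintro m' ⟨hF, h2, hG, -⟩
    exact ⟨hF, h2, hG⟩

/-- Given the slopes `s`, point `j` is to be discarded before point `i`: points of larger slope
come first, and among points of equal slope those of smaller index. -/
def Before (s : ℕ → ℝ) (j i : ℕ) : Prop :=
  s i ≤ s j ∧ ¬ (s j ≤ s i ∧ i ≤ j)

open Classical in
/-- The number of points below `k` to be discarded before point `i`. -/
noncomputable def rankBelow (s : ℕ → ℝ) (i k : ℕ) : ℕ :=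
  Nat.count (fun j => Before s j i) k

theorem rankPass_halts (e : Env) {n i : ℕ} {m : Mem} (hn : m.idx 0 = n) (hi : m.idx 1 = i) :
    Halts e rankPass m (n * 38 + 8) fun m' =>
      m'.idx 0 = n ∧ m'.idx 1 = i ∧ m'.idx 3 = rankBelow (m.cell 1) i n ∧ m'.cell = m.cell := by
  refine Halts.seq 2 (n * (30 + 8) + 6) (Halts.setIdx ?_ (by simp [IExp.cost])) (by linarith)
  refine Halts.forTo (N := n) (fun k m' => m'.idx 0 = n ∧ m'.idx 1 = i ∧
    m'.idx 3 = rankBelow (m.cell 1) i k ∧ m'.cell = m.cell) 30 (by norm_num) (by simpa using hn)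
    ?_ ?_ (fun _ h => h) le_rfl
  · simp [hn, hi, IExp.eval, rankBelow]
  · rintro k hk m₁ ⟨h0, h1, h3, hc⟩ hk2 -
    have htest : beforeTest.holds e m₁ ↔ Before (m.cell 1) k i := by
      simp [beforeTest, BExp.holds, RExp.eval, IExp.eval, h1, hk2, hc, Before]
    refine Halts.branch 5 ?_ ?_ (by simp [beforeTest, BExp.cost, RExp.cost, IExp.cost])
    · intro hb
      refine Halts.setIdx ?_ (by simp [IExp.cost])
      simp [hk2, h0, h1, h3, hc, IExp.eval, rankBelow, Nat.count_succ, htest.1 hb]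
    · intro hb
      refine Halts.skip ?_ (by norm_num)
      simp [hk2, h0, h1, h3, hc, rankBelow, Nat.count_succ, mt htest.2 hb]

/-- The flags `f` mark, among the points below `k` satisfying `kept`, a `t`-packing (with respect
to `d`) that is a `t`-cover of these points. -/
structure IsNetBelow (d : ℕ → ℕ → ℝ) (t : ℝ) (kept : ℕ → Prop) (k : ℕ) (f : ℕ → ℝ) : Prop where
  zero_or_one : ∀ i, f i = 0 ∨ f i = 1
  below : ∀ i, f i = 1 → i < k ∧ kept i
  packing : ∀ i j, j < i → f i = 1 → f j = 1 → t ≤ d i j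
  cover : ∀ i < k, kept i → f i = 1 ∨ ∃ j, f j = 1 ∧ d i j < t

/-- The greedy step in the construction of a net. -/
theorem IsNetBelow.update {d : ℕ → ℕ → ℝ} {t : ℝ} {kept : ℕ → Prop} {k : ℕ} {f : ℕ → ℝ}
    (h : IsNetBelow d t kept k f) {b : ℝ} (hb : b = 0 ∨ b = 1)
    (h1 : b = 1 → kept k ∧ ∀ j < k, f j = 1 → t ≤ d k j)
    (h0 : b = 0 → kept k → ∃ j < k, f j = 1 ∧ d k j < t) :
    IsNetBelow d t kept (k + 1) (Function.update f k b) := by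
  have hne : ∀ i, f i = 1 → i ≠ k := fun i hi => (h.below i hi).1.ne
  refine ⟨fun i => ?_, fun i hi => ?_, fun i j hji hi hj => ?_, fun i hi hki => ?_⟩
  · rcases eq_or_ne i k with rfl | hik
    · simpa using hb
    · simpa [hik] using h.zero_or_one i
  · rcases eq_or_ne i k with rfl | hik
    · exact ⟨by omega, (h1 (by simpa using hi)).1⟩
    · have := h.below i (by simpa [hik] using hi)
      exact ⟨by omega, this.2⟩
  · rcases eq_or_ne i k with rfl | hik
    · exact (h1 (by simpa using hi)).2 j hji (by simpa [hji.ne] using hj)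
    · have hi' : f i = 1 := by simpa [hik] using hi
      have hjk : j ≠ k := by have := (h.below i hi').1; omega
      exact h.packing i j hji hi' (by simpa [hjk] using hj)
  · have lift : (∃ j, f j = 1 ∧ d i j < t) → ∃ j, Function.update f k b j = 1 ∧ d i j < t := by
      rintro ⟨j, hj, hd⟩
      exact ⟨j, by simpa [hne j hj] using hj, hd⟩
    rcases Nat.lt_succ_iff_lt_or_eq.1 hi with hi | rfl
    · rcases h.cover i hi hki with h' | h'
      · exact .inl (by simpa [hi.ne] using h')
      · exact .inr (lift h')
    · rcases hb with hb | hb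
      · obtain ⟨j, -, hj⟩ := h0 hb hki
        exact .inr (lift ⟨j, hj⟩)
      · exact .inl (by simpa using hb)

theorem netPass_halts (e : Env) {n : ℕ} {p q : ℕ → ℝ} {m : Mem} (hm : Frame n p q m)
    (h2 : ∀ i, m.cell 2 i = 0) :
    Halts e netPass m (n * (n * 88 + 60) + 6) fun m' => Frame n p q m' ∧
      IsNetBelow e.distance (q 1)
        (fun i => ¬ ((rankBelow (m.cell 1) i n + 1 : ℕ) : ℝ) ≤ q 0 * n) n (m'.cell 2) := by
  obtain ⟨hn, hp, hq, h4⟩ := hm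
  set kept : ℕ → Prop := fun i => ¬ ((rankBelow (m.cell 1) i n + 1 : ℕ) : ℝ) ≤ q 0 * n with hkept
  refine Halts.forTo (N := n) (fun k m' => Frame n p q m' ∧ m'.cell 1 = m.cell 1 ∧
    IsNetBelow e.distance (q 1) kept k (m'.cell 2)) (n * 88 + 52) (by norm_num) hn ?_ ?_
    (fun _ h => ⟨h.1, h.2.2⟩) (by linarith)
  · refine ⟨⟨by simpa using hn, hp, hq, h4⟩, rfl, ⟨fun i => .inl (h2 i), ?_, ?_, by simp⟩⟩ <;>
    simp [h2]
  · rintro k hk m₁ ⟨⟨h10, h1p, h1q, h14⟩, hs, hnet⟩ hk1 -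
    refine Halts.seq (n * 38 + 8) (n * 50 + 44) ?_ (by linarith)
    obtain ⟨s, hs', m₂, hrun, h20, h21, h23, hc⟩ := rankPass_halts e h10 hk1
    refine ⟨s, hs', m₂, hrun, ?_⟩
    have hcell0 : m₂.cell 2 k = 0 := by
      rw [hc]
      refine (hnet.zero_or_one k).resolve_right fun h => ?_
      exact absurd (hnet.below k h).1 (lt_irrefl k)
    rw [hs] at h23
    refine Halts.seq 30 (n * (42 + 8) + 6) ?_ (by linarith)
    have hloop : ∀ m₃ : Mem, m₃.idx 0 = n → m₃.idx 1 = k → m₃.cell 0 = p → m₃.cell 3 = q →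
        (∀ i, m₃.cell 4 i = 0) → m₃.cell 1 = m.cell 1 →
        ∀ b : ℝ, m₃.cell 2 = Function.update (m₁.cell 2) k b →
        (b = 0 ∧ ¬ kept k ∨ b = 1 ∧ kept k) →
        Halts e (forTo 2 1 (.branch
          (.and (.leReal (.ofIdx (.lit 1)) (.cell 2 (.reg 2)))
            (.not (.leReal (.cell 3 (.lit 1)) (.distance (.reg 1) (.reg 2)))))
          (.setCell 2 (.reg 1) (.ofIdx (.lit 0))) .skip)) m₃ (n * (42 + 8) + 6)
          fun m₄ => m₄.idx 1 = k ∧ m₄.idx 0 = n ∧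
            ((Frame n p q { m₄ with idx := Function.update m₄.idx 1 (k + 1) }) ∧
              m₄.cell 1 = m.cell 1 ∧
              IsNetBelow e.distance (q 1) kept (k + 1) (m₄.cell 2)) := by
      intro m₃ h30 h31 h3p h3q h34 h3s b hb hb'
      refine Halts.forTo (N := k) (fun l m' => l ≤ k ∧ m'.idx 0 = n ∧ m'.idx 1 = k ∧
        m'.cell 0 = p ∧ m'.cell 3 = q ∧ (∀ i, m'.cell 4 i = 0) ∧ m'.cell 1 = m.cell 1 ∧
        ∃ b : ℝ, m'.cell 2 = Function.update (m₁.cell 2) k b ∧ (b = 0 ∨ b = 1) ∧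
          (b = 1 → kept k ∧ ∀ j < l, m₁.cell 2 j = 1 → q 1 ≤ e.distance k j) ∧
          (b = 0 → kept k → ∃ j < l, m₁.cell 2 j = 1 ∧ e.distance k j < q 1))
        42 (by norm_num) h31 ?_ ?_ ?_ (by nlinarith)
      · refine ⟨Nat.zero_le _, by simpa using h30, by simpa using h31, h3p, h3q, h34, h3s,
          b, hb, ?_, ?_, ?_⟩
        · rcases hb' with h | h
          exacts [.inl h.1, .inr h.1]
        · intro h1
          rcases hb' with h | h
          · exact absurd (h.1.symm.trans h1) zero_ne_one
          · exact ⟨h.2, by simp⟩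
        · intro h0 hk'
          rcases hb' with h | h
          · exact absurd hk' h.2
          · exact absurd (h0.symm.trans h.1) zero_ne_one
      · rintro l hl m₄ ⟨-, h40, h41, h4p, h4q, h44, h4s, b, hb, hb01, hb1, hb0⟩ hl2 -
        have hflag : m₄.cell 2 l = m₁.cell 2 l := by rw [hb]; simp [hl.ne]
        have htest : (BExp.and (.leReal (.ofIdx (.lit 1)) (.cell 2 (.reg 2)))
            (.not (.leReal (.cell 3 (.lit 1)) (.distance (.reg 1) (.reg 2))))).holds e m₄ ↔
            m₁.cell 2 l = 1 ∧ e.distance k l < q 1 := by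
          simp only [BExp.holds, RExp.eval, IExp.eval, hl2, h41, hflag, h4q, not_le,
            Nat.cast_one]
          refine and_congr_left fun _ => ⟨fun h => ?_, fun h => h.ge⟩
          refine (hnet.zero_or_one l).resolve_left fun h0 => ?_
          rw [h0] at h; linarith
        refine Halts.branch 10 ?_ ?_ (by simp [BExp.cost, RExp.cost, IExp.cost])
        · intro hB
          obtain ⟨hB1, hB2⟩ := htest.1 hB
          refine Halts.setCell ?_ (by simp [RExp.cost, IExp.cost])
          refine ⟨hl2, h41, hl, ?_⟩
          refine ⟨by simpa using h40, by simpa using h41, by simpa using h4p, by simpa using h4q,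
            by simpa using h44, by simpa using h4s, 0, ?_, .inl rfl, ?_, ?_⟩
          · simp [hb, h41, IExp.eval, RExp.eval]
          · exact fun h => absurd h zero_ne_one
          · exact fun _ _ => ⟨l, by omega, hB1, hB2⟩
        · intro hB
          rw [htest] at hB
          refine Halts.skip ?_ (by norm_num)
          refine ⟨hl2, h41, hl, by simpa using h40, by simpa using h41, h4p, h4q, h44, h4s, b, hb,
            hb01, ?_, ?_⟩
          · intro h1
            refine ⟨(hb1 h1).1, fun j hj hj1 => ?_⟩
            rcases Nat.lt_succ_iff_lt_or_eq.1 hj with hj | rfl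
            · exact (hb1 h1).2 j hj hj1
            · exact not_lt.1 fun hd => hB ⟨hj1, hd⟩
          · intro h0 hk'
            obtain ⟨j, hj, hj'⟩ := hb0 h0 hk'
            exact ⟨j, by omega, hj'⟩
      · rintro m₄ ⟨-, h40, h41, h4p, h4q, h44, h4s, b, hb, hb01, hb1, hb0⟩
        refine ⟨h41, h40, ⟨by simpa using h40, h4p, h4q, h44⟩, h4s, ?_⟩
        rw [hb]
        exact hnet.update hb01 hb1 hb0
    have hcond : (BExp.leReal (.ofIdx (.add (.reg 3) (.lit 1)))
        (.mul (.cell 3 (.lit 0)) (.ofIdx (.reg 0)))).holds e m₂ ↔ ¬ kept k := by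
      simp [BExp.holds, RExp.eval, IExp.eval, h23, hc, h1q, h20, hkept]
    refine Halts.branch 10 ?_ ?_ (by simp [BExp.cost, RExp.cost, IExp.cost])
    · intro hB
      refine Halts.skip ?_ (by norm_num)
      refine hloop m₂ h20 h21 (by rw [hc, h1p]) (by rw [hc, h1q]) (by rw [hc]; exact h14)
        (by rw [hc, hs]) 0 ?_ (.inl ⟨rfl, hcond.1 hB⟩)
      rw [← hcell0, hc, Function.update_eq_self]
    · intro hB
      refine Halts.setCell ?_ (by simp [RExp.cost, IExp.cost])
      refine hloop _ h20 h21 (by simp [hc, h1p]) (by simp [hc, h1q]) (by simpa [hc] using h14)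
        (by simp [hc, hs]) 1 ?_ (.inr ⟨rfl, not_not.1 fun h => hB (hcond.2 h)⟩)
      simp [hc, h21, IExp.eval, RExp.eval]

theorem paramPass_halts (e : Env) {β L ε : ℝ} {n : ℕ} :
    Halts e paramPass (startMem β L ε n) 40 fun m' =>
      (∃ q, Frame n ((startMem β L ε n).cell 0) q m' ∧ q 0 = trimLevel ε L ∧
        q 1 = trimLevel ε L ^ (1 / β)) ∧ (∀ i, m'.cell 1 i = 0) ∧ ∀ i, m'.cell 2 i = 0 := by
  have hend : ∀ m₁ : Mem, m₁.idx 0 = n → m₁.cell 0 = (startMem β L ε n).cell 0 →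
      m₁.cell 3 0 = trimLevel ε L → (∀ i, m₁.cell 1 i = 0) → (∀ i, m₁.cell 2 i = 0) →
      (∀ i, m₁.cell 4 i = 0) →
      Halts e (.setCell 3 (.lit 1) (.pow (.cell 3 (.lit 0)) (.div (.ofIdx (.lit 1))
        (.cell 0 (.lit 0))))) m₁ 12 fun m' =>
      (∃ q, Frame n ((startMem β L ε n).cell 0) q m' ∧ q 0 = trimLevel ε L ∧
        q 1 = trimLevel ε L ^ (1 / β)) ∧ (∀ i, m'.cell 1 i = 0) ∧ ∀ i, m'.cell 2 i = 0 := by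
    intro m₁ hn h0 h3 h1 h2 h4
    refine Halts.setCell ?_ (by simp [RExp.cost, IExp.cost])
    refine ⟨⟨_, ⟨by simpa using hn, by simpa using h0, rfl, by simpa using h4⟩, ?_, ?_⟩,
      by simpa using h1, by simpa using h2⟩
    · simp [IExp.eval, h3]
    · simp [IExp.eval, RExp.eval, h3, h0, startMem]
  refine Halts.seq 28 12 ?_ (by norm_num)
  refine Halts.branch 18 ?_ ?_ (by simp [BExp.cost, RExp.cost, IExp.cost])
  all_goals
    intro hb
    simp only [BExp.holds, RExp.eval, IExp.eval, startMem] at hb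
    refine Halts.setCell ?_ (by simp [RExp.cost, IExp.cost])
    refine hend _ ?_ ?_ ?_ ?_ ?_ ?_
  · simp [startMem]
  · simp
  · rw [trimLevel, if_pos (show 1 / 2 ≤ ε by simpa using hb)]
    simp [IExp.eval, RExp.eval]
  · simp [startMem]
  · simp [startMem]
  · simp [startMem]
  · simp [startMem]
  · simp
  · rw [trimLevel, if_neg (show ¬ 1 / 2 ≤ ε by simpa using hb)]
    simp [IExp.eval, RExp.eval, startMem]
  · simp [startMem]
  · simp [startMem]
  · simp [startMem]

/-- `R_x(u, v)` for the points `u, v` of numbers `a, b` and the query point `x` of number `n`. -/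
noncomputable def envRatio (e : Env) (β : ℝ) (n a b : ℕ) : ℝ :=
  (e.label b - e.label a) / (e.distance n b ^ β + e.distance n a ^ β)

/-- The values `R_x(u, v)` over the flagged pairs that satisfy `P`, together with `0`. -/
def ratioSet (e : Env) (β : ℝ) (n : ℕ) (f : ℕ → ℝ) (P : ℕ → ℕ → Prop) : Set ℝ :=
  insert 0 {z | ∃ a b, P a b ∧ f a = 1 ∧ f b = 1 ∧ z = envRatio e β n a b}

/-- The values `g u + R ρ(x, u) ^ β` over the flagged points of number below `k`, together
with `2`. -/
def valueSet (e : Env) (β R : ℝ) (n : ℕ) (f : ℕ → ℝ) (k : ℕ) : Set ℝ :=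
  insert 2 {z | ∃ a < k, f a = 1 ∧ z = e.label a + R * e.distance n a ^ β}

theorem ratioSet_of_insert {e : Env} {β : ℝ} {n : ℕ} {f : ℕ → ℝ} {P P' : ℕ → ℕ → Prop} {k l : ℕ}
    (hP : ∀ a b, P' a b ↔ P a b ∨ a = k ∧ b = l) (hk : f k = 1) (hl : f l = 1) :
    ratioSet e β n f P' = insert (envRatio e β n k l) (ratioSet e β n f P) := by
  ext z
  simp only [ratioSet, Set.mem_insert_iff, Set.mem_ofPred_eq, hP]
  constructor
  · rintro (h | ⟨a, b, h | ⟨rfl, rfl⟩, ha, hb, rfl⟩)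
    · exact .inr (.inl h)
    · exact .inr (.inr ⟨a, b, h, ha, hb, rfl⟩)
    · exact .inl rfl
  · rintro (rfl | h | ⟨a, b, h, ha, hb, rfl⟩)
    · exact .inr ⟨k, l, .inr ⟨rfl, rfl⟩, hk, hl, rfl⟩
    · exact .inl h
    · exact .inr ⟨a, b, .inl h, ha, hb, rfl⟩

theorem ratioSet_congr {e : Env} {β : ℝ} {n : ℕ} {f : ℕ → ℝ} {P P' : ℕ → ℕ → Prop}
    (hP : ∀ a b, f a = 1 → f b = 1 → (P' a b ↔ P a b)) :
    ratioSet e β n f P' = ratioSet e β n f P := by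
  ext z
  simp only [ratioSet, Set.mem_insert_iff, Set.mem_ofPred_eq]
  refine or_congr_right (exists_congr fun a => exists_congr fun b => ?_)
  constructor
  · rintro ⟨h, ha, hb, hz⟩
    exact ⟨(hP a b ha hb).1 h, ha, hb, hz⟩
  · rintro ⟨h, ha, hb, hz⟩
    exact ⟨(hP a b ha hb).2 h, ha, hb, hz⟩

theorem one_le_flag_iff {f : ℕ → ℝ} (hf : ∀ i, f i = 0 ∨ f i = 1) (i : ℕ) : 1 ≤ f i ↔ f i = 1 := by
  rcases hf i with h | h <;> simp [h]

theorem ratioPass_halts (e : Env) {n : ℕ} {p f : ℕ → ℝ} {m : Mem} (hf : ∀ i, f i = 0 ∨ f i = 1)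
    (h0 : m.idx 0 = n) (hp : m.cell 0 = p) (h2 : m.cell 2 = f) (h4 : m.cell 4 0 = 0) :
    Halts e ratioPass m (n * (n * 88 + 14) + 6) fun m' => m'.idx 0 = n ∧ m'.cell 0 = p ∧
      m'.cell 2 = f ∧
      IsGreatest (ratioSet e (p 0) n f fun a b => a < n ∧ b < n) (m'.cell 4 0) := by
  refine Halts.forTo (N := n) (fun k m' => m'.idx 0 = n ∧ m'.cell 0 = p ∧ m'.cell 2 = f ∧
      IsGreatest (ratioSet e (p 0) n f fun a b => a < k ∧ b < n) (m'.cell 4 0))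
    (n * (80 + 8) + 6) (by norm_num) h0 ?_ ?_ (fun _ h => h) (by linarith)
  · refine ⟨by simpa using h0, hp, h2, ?_⟩
    simp [ratioSet, h4]
  · rintro k hk m₁ ⟨h0, hp, h2, hG⟩ hk1 -
    refine Halts.forTo (N := n) (fun l m' => m'.idx 0 = n ∧ m'.idx 1 = k ∧ m'.cell 0 = p ∧
        m'.cell 2 = f ∧ IsGreatest
          (ratioSet e (p 0) n f fun a b => a < k ∧ b < n ∨ a = k ∧ b < l) (m'.cell 4 0))
      80 (by norm_num) h0 ?_ ?_ ?_ le_rfl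
    · refine ⟨by simpa using h0, by simpa using hk1, hp, h2, ?_⟩
      simpa using hG
    · rintro l hl m₂ ⟨h0, h1, hp, h2, hG⟩ hl2 -
      have hrat : ratioExp.eval e m₂ = envRatio e (p 0) n k l := by
        simp [ratioExp, RExp.eval, IExp.eval, envRatio, h0, h1, hl2, hp]
      have htest : (BExp.and (.leReal (.ofIdx (.lit 1)) (.cell 2 (.reg 1)))
          (.and (.leReal (.ofIdx (.lit 1)) (.cell 2 (.reg 2)))
            (.not (.leReal ratioExp (.cell 4 (.lit 0)))))).holds e m₂ ↔
          f k = 1 ∧ f l = 1 ∧ m₂.cell 4 0 < envRatio e (p 0) n k l := by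
        simp only [BExp.holds, hrat, RExp.eval, IExp.eval, h1, hl2, h2, Nat.cast_one, not_le,
          one_le_flag_iff hf]
      have hP : ∀ a b, (a < k ∧ b < n ∨ a = k ∧ b < l + 1) ↔
          (a < k ∧ b < n ∨ a = k ∧ b < l) ∨ a = k ∧ b = l := by
        intro a b; omega
      refine Halts.branch 35 ?_ ?_ (by simp [BExp.cost, RExp.cost, IExp.cost, ratioExp])
      · intro hB
        obtain ⟨hfk, hfl, hlt⟩ := htest.1 hB
        refine Halts.setCell ?_ (by simp [RExp.cost, IExp.cost, ratioExp])
        rw [hrat]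
        refine ⟨hl2, h0, by simpa using h0, by simpa using h1, by simpa using hp,
          by simpa using h2, ?_⟩
        simpa [IExp.eval] using isGreatest_of_insert hG (ratioSet_of_insert hP hfk hfl) hlt.le
      · intro hB
        rw [htest] at hB
        refine Halts.skip ?_ (by norm_num)
        refine ⟨hl2, h0, by simpa using h0, by simpa using h1, hp, h2, ?_⟩
        by_cases hfl : f k = 1 ∧ f l = 1
        · exact isGreatest_of_insert_le hG (ratioSet_of_insert hP hfl.1 hfl.2)
            (not_lt.1 fun h => hB ⟨hfl.1, hfl.2, h⟩)
        · rw [ratioSet_congr (P := fun a b => a < k ∧ b < n ∨ a = k ∧ b < l)]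
          · exact hG
          · intro a b ha hb
            rw [hP]
            refine or_iff_left ?_
            rintro ⟨rfl, rfl⟩
            exact hfl ⟨ha, hb⟩
    · rintro m₃ ⟨h0, h1, hp, h2, hG⟩
      refine ⟨h1, h0, by simpa using h0, hp, h2, ?_⟩
      rw [ratioSet_congr (P := fun a b => a < k ∧ b < n ∨ a = k ∧ b < n)]
      · exact hG
      · intro a b _ _
        omega

theorem valueSet_succ {e : Env} {β R : ℝ} {n : ℕ} {f : ℕ → ℝ} {k : ℕ} (hk : f k = 1) :
    valueSet e β R n f (k + 1) =
      insert (e.label k + R * e.distance n k ^ β) (valueSet e β R n f k) := by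
  ext z
  simp only [valueSet, Set.mem_insert_iff, Set.mem_ofPred_eq, Nat.lt_succ_iff_lt_or_eq]
  constructor
  · rintro (h | ⟨j, hj | rfl, hd, rfl⟩)
    · exact .inr (.inl h)
    · exact .inr (.inr ⟨j, hj, hd, rfl⟩)
    · exact .inl rfl
  · rintro (rfl | h | ⟨j, hj, hd, rfl⟩)
    · exact .inr ⟨k, .inr rfl, hk, rfl⟩
    · exact .inl h
    · exact .inr ⟨j, .inl hj, hd, rfl⟩

theorem valueSet_succ_of_ne {e : Env} {β R : ℝ} {n : ℕ} {f : ℕ → ℝ} {k : ℕ} (hk : f k ≠ 1) :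
    valueSet e β R n f (k + 1) = valueSet e β R n f k := by
  ext z
  simp only [valueSet, Set.mem_insert_iff, Set.mem_ofPred_eq, Nat.lt_succ_iff_lt_or_eq]
  constructor
  · rintro (h | ⟨j, hj | rfl, hd, rfl⟩)
    · exact .inl h
    · exact .inr ⟨j, hj, hd, rfl⟩
    · exact absurd hd hk
  · rintro (h | ⟨j, hj, hd, rfl⟩)
    · exact .inl h
    · exact .inr ⟨j, .inl hj, hd, rfl⟩

theorem valuePass_halts (e : Env) {n : ℕ} {p f : ℕ → ℝ} {R : ℝ} {m : Mem}
    (hf : ∀ i, f i = 0 ∨ f i = 1)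
    (h0 : m.idx 0 = n) (hp : m.cell 0 = p) (h2 : m.cell 2 = f) (h4 : m.cell 4 0 = R) :
    Halts e valuePass m (n * 58 + 10) fun m' =>
      IsLeast (valueSet e (p 0) R n f n) (m'.cell 4 1) := by
  refine Halts.seq 4 (n * (50 + 8) + 6) (Halts.setCell ?_ (by simp [RExp.cost, IExp.cost]))
    (by linarith)
  refine Halts.forTo (N := n) (fun k m' => m'.idx 0 = n ∧ m'.cell 0 = p ∧ m'.cell 2 = f ∧
    m'.cell 4 0 = R ∧ IsLeast (valueSet e (p 0) R n f k) (m'.cell 4 1)) 50 (by norm_num) h0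
    ?_ ?_ (fun _ h => h.2.2.2.2) le_rfl
  · refine ⟨by simpa using h0, by simpa using hp, by simpa using h2, ?_, ?_⟩
    · simpa [IExp.eval] using h4
    · simp [valueSet, IExp.eval, RExp.eval]
  · rintro k hk m₁ ⟨h0, hp, h2, h4, hG⟩ hk1 -
    have hval : valueExp.eval e m₁ = e.label k + R * e.distance n k ^ p 0 := by
      simp [valueExp, RExp.eval, IExp.eval, h0, hk1, hp, h4]
    have htest : (BExp.and (.leReal (.ofIdx (.lit 1)) (.cell 2 (.reg 1)))
        (.not (.leReal (.cell 4 (.lit 1)) valueExp))).holds e m₁ ↔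
        f k = 1 ∧ e.label k + R * e.distance n k ^ p 0 < m₁.cell 4 1 := by
      simp only [BExp.holds, hval, RExp.eval, IExp.eval, hk1, h2, Nat.cast_one, not_le,
        one_le_flag_iff hf]
    refine Halts.branch 20 ?_ ?_ (by simp [BExp.cost, RExp.cost, IExp.cost, valueExp])
    · intro hB
      obtain ⟨hfk, hlt⟩ := htest.1 hB
      refine Halts.setCell ?_ (by simp [RExp.cost, IExp.cost, valueExp])
      rw [hval]
      refine ⟨by simpa using hk1, h0, by simpa using h0, by simpa using hp, by simpa using h2,
        by simpa [IExp.eval] using h4, ?_⟩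
      have := hG.insert (e.label k + R * e.distance n k ^ p 0)
      rw [min_eq_left hlt.le, ← valueSet_succ hfk] at this
      simpa [IExp.eval] using this
    · intro hB
      rw [htest] at hB
      refine Halts.skip ?_ (by norm_num)
      refine ⟨hk1, h0, by simpa using h0, hp, h2, h4, ?_⟩
      by_cases hfk : f k = 1
      · have := hG.insert (e.label k + R * e.distance n k ^ p 0)
        rwa [min_eq_right (not_lt.1 fun h => hB ⟨hfk, h⟩), ← valueSet_succ hfk] at this
      · rwa [valueSet_succ_of_ne hfk]

/-- What training achieves: the flags in array `2` mark a net of the points that are not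
discarded. -/
theorem train_halts (e : Env) {β L ε : ℝ} {n : ℕ} :
    Halts e trimNetExtend.train (startMem β L ε n) (n * (n * 176 + 74) + 52) fun m =>
      m.idx 0 = n ∧ m.cell 0 = (startMem β L ε n).cell 0 ∧ m.cell 4 0 = 0 ∧
      ∃ s : ℕ → ℝ, (∀ i < n, IsGreatest (slopeSet e β i n) (s i)) ∧
        IsNetBelow e.distance (trimLevel ε L ^ (1 / β))
          (fun i => ¬ ((rankBelow s i n + 1 : ℕ) : ℝ) ≤ trimLevel ε L * n) n (m.cell 2) := by
  refine Halts.seq 40 (n * (n * 176 + 74) + 12) ?_ (by linarith)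
  obtain ⟨t₁, ht₁, m₁, hr₁, ⟨q, hF, hq0, hq1⟩, h1, h2⟩ :=
    paramPass_halts e (β := β) (L := L) (ε := ε) (n := n)
  refine ⟨t₁, ht₁, m₁, hr₁, ?_⟩
  refine Halts.seq (n * (n * 88 + 14) + 6) (n * (n * 88 + 60) + 6) ?_ (by linarith)
  obtain ⟨t₂, ht₂, m₂, hr₂, hF, h2, hs⟩ := slopePass_halts e hF h1 h2
  refine ⟨t₂, ht₂, m₂, hr₂, ?_⟩
  obtain ⟨t₃, ht₃, m₃, hr₃, hF, hnet⟩ := netPass_halts e hF h2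
  refine ⟨t₃, ht₃, m₃, hr₃, hF.1, hF.2.1, hF.2.2.2 0, m₂.cell 1, ?_, ?_⟩
  · simpa [startMem] using hs
  · rwa [hq0, hq1] at hnet

theorem predict_halts (e : Env) {n : ℕ} {p f : ℕ → ℝ} {m : Mem} (hf : ∀ i, f i = 0 ∨ f i = 1)
    (h0 : m.idx 0 = n) (hp : m.cell 0 = p) (h2 : m.cell 2 = f) (h4 : m.cell 4 0 = 0) :
    Halts e trimNetExtend.predict m (n * (n * 88 + 72) + 40) fun m' =>
      ∃ R v, IsGreatest (ratioSet e (p 0) n f fun a b => a < n ∧ b < n) R ∧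
        IsLeast (valueSet e (p 0) R n f n) v ∧ m'.cell 0 0 = if 2 ≤ v then 1 / 2 else v := by
  refine Halts.seq (n * (n * 88 + 14) + 6) (n * 58 + 34) ?_ (by linarith)
  obtain ⟨t₁, ht₁, m₁, hr₁, h0, hp, h2, hR⟩ := ratioPass_halts e hf h0 hp h2 h4
  refine ⟨t₁, ht₁, m₁, hr₁, ?_⟩
  refine Halts.seq (n * 58 + 10) 20 ?_ (by linarith)
  obtain ⟨t₂, ht₂, m₂, hr₂, hv⟩ := valuePass_halts e hf h0 hp h2 rfl
  refine ⟨t₂, ht₂, m₂, hr₂, ?_⟩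
  refine Halts.branch 10 ?_ ?_ (by simp [BExp.cost, RExp.cost, IExp.cost])
  · intro hB
    refine Halts.setCell ⟨_, _, hR, hv, ?_⟩ (by simp [RExp.cost, IExp.cost])
    have : 2 ≤ m₂.cell 4 1 := by simpa [BExp.holds, RExp.eval, IExp.eval] using hB
    simp [RExp.eval, IExp.eval, this]
  · intro hB
    refine Halts.setCell ⟨_, _, hR, hv, ?_⟩ (by simp [RExp.cost, IExp.cost])
    have : ¬ 2 ≤ m₂.cell 4 1 := by simpa [BExp.holds, RExp.eval, IExp.eval] using hB
    simp [RExp.eval, IExp.eval, this]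

end RealRAM

/-! ### The pointwise minimum slope extension of a function on a finite set -/

namespace PMSE

variable {Ω : Type*} [MetricSpace Ω] {β : ℝ} {A : Set Ω} {g : Ω → ℝ} {x u v w : Ω}

/-- The lower envelope `x ↦ min_w (g w + R*_x ρ(x, w) ^ β)` over `w ∈ A`, which is the `β`-PMSE
extension of `g|_A` when `A` is finite and nonempty. -/
noncomputable def envelope (β : ℝ) (A : Set Ω) (g : Ω → ℝ) (x : Ω) : ℝ :=
  ⨅ w : A, (g w + maxRatio β A g x * dist x w ^ β)

theorem ratio_mul (hβ : 0 < β) (g : Ω → ℝ) (x u v : Ω) :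
    ratio β g x u v * (dist x v ^ β + dist x u ^ β) = g v - g u := by
  have hv := Real.rpow_nonneg (dist_nonneg (x := x) (y := v)) β
  have hu := Real.rpow_nonneg (dist_nonneg (x := x) (y := u)) β
  by_cases h : dist x v ^ β + dist x u ^ β = 0
  · -- both distances vanish, so that `u = x = v`
    have hv0 : dist x v ^ β = 0 := by linarith
    have hu0 : dist x u ^ β = 0 := by linarith
    rw [Real.rpow_eq_zero dist_nonneg hβ.ne', dist_eq_zero] at hv0 hu0
    rw [← hv0, ← hu0]
    simp [Real.zero_rpow hβ.ne']
  · rw [ratio, div_mul_cancel₀ _ h]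

theorem ratio_le_maxRatio [Finite A] (hu : u ∈ A) (hv : v ∈ A) :
    ratio β g x u v ≤ maxRatio β A g x :=
  le_ciSup (f := fun p : A × A => ratio β g x p.1 p.2) (Set.finite_range _).bddAbove
    (⟨u, hu⟩, ⟨v, hv⟩)

theorem exists_ratio_eq_maxRatio [Finite A] (hA : A.Nonempty) (β : ℝ) (g : Ω → ℝ) (x : Ω) :
    ∃ u ∈ A, ∃ v ∈ A, ratio β g x u v = maxRatio β A g x := by
  have : Nonempty A := hA.to_subtype
  obtain ⟨p, hp⟩ := exists_eq_ciSup_of_finite (f := fun p : A × A => ratio β g x p.1 p.2)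
  exact ⟨p.1, p.1.2, p.2, p.2.2, hp⟩

theorem maxRatio_nonneg [Finite A] (hA : A.Nonempty) : 0 ≤ maxRatio β A g x := by
  obtain ⟨u, hu⟩ := hA
  simpa [ratio] using ratio_le_maxRatio (β := β) (g := g) (x := x) hu hu

theorem sub_le_maxRatio_mul [Finite A] (hβ : 0 < β) (hu : u ∈ A) (hv : v ∈ A) :
    g v - g u ≤ maxRatio β A g x * (dist x v ^ β + dist x u ^ β) := by
  rw [← ratio_mul hβ g x u v]
  have hv' := Real.rpow_nonneg (dist_nonneg (x := x) (y := v)) β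
  have hu' := Real.rpow_nonneg (dist_nonneg (x := x) (y := u)) β
  exact mul_le_mul_of_nonneg_right (ratio_le_maxRatio hu hv) (by linarith)

/-- Every pair that attains the maximal ratio interpolates to the value of the envelope, from
either of its two points. -/
theorem envelope_eq_of_ratio_eq [Finite A] (hβ : 0 < β) (hu : u ∈ A) (hv : v ∈ A)
    (h : ratio β g x u v = maxRatio β A g x) :
    envelope β A g x = g u + maxRatio β A g x * dist x u ^ β ∧
      envelope β A g x = g v - maxRatio β A g x * dist x v ^ β := by
  have : Nonempty A := ⟨⟨u, hu⟩⟩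
  have hmul := ratio_mul hβ g x u v
  rw [h] at hmul
  have h1 : envelope β A g x = g u + maxRatio β A g x * dist x u ^ β := by
    refine le_antisymm ?_ (le_ciInf fun w => ?_)
    · exact ciInf_le (f := fun w : A => g w + maxRatio β A g x * dist x w ^ β)
        (Set.finite_range _).bddBelow ⟨u, hu⟩
    · have := sub_le_maxRatio_mul (β := β) (g := g) (x := x) hβ w.2 hv
      linarith
  exact ⟨h1, by linarith⟩

theorem envelope_sub_le [Finite A] (hw : w ∈ A) :
    envelope β A g x - g w ≤ maxRatio β A g x * dist x w ^ β := by
  have : envelope β A g x ≤ g w + maxRatio β A g x * dist x w ^ β :=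
    ciInf_le (f := fun w : A => g w + maxRatio β A g x * dist x w ^ β)
      (Set.finite_range _).bddBelow ⟨w, hw⟩
  linarith

theorem sub_envelope_le [Finite A] (hβ : 0 < β) (hw : w ∈ A) :
    g w - envelope β A g x ≤ maxRatio β A g x * dist x w ^ β := by
  obtain ⟨u, hu, v, hv, h⟩ := exists_ratio_eq_maxRatio ⟨w, hw⟩ β g x
  have := (envelope_eq_of_ratio_eq hβ hu hv h).1
  have := sub_le_maxRatio_mul (β := β) (g := g) (x := x) hβ hu hw
  linarith

theorem envelope_mem_Icc [Finite A] (hβ : 0 < β) (hA : A.Nonempty) {a b : ℝ}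
    (hg : ∀ w ∈ A, g w ∈ Set.Icc a b) : envelope β A g x ∈ Set.Icc a b := by
  obtain ⟨u, hu, v, hv, h⟩ := exists_ratio_eq_maxRatio hA β g x
  obtain ⟨h1, h2⟩ := envelope_eq_of_ratio_eq hβ hu hv h
  have hR := maxRatio_nonneg (β := β) (g := g) (x := x) hA
  have hpu := mul_nonneg hR (Real.rpow_nonneg (dist_nonneg (x := x) (y := u)) β)
  have hpv := mul_nonneg hR (Real.rpow_nonneg (dist_nonneg (x := x) (y := v)) β)
  exact ⟨by linarith [(hg u hu).1], by linarith [(hg v hv).2]⟩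

theorem isExtension_envelope [Finite A] (hβ : 0 < β) :
    IsExtension β A g (envelope β A g) := by
  refine fun x => ⟨?_, ?_⟩
  · rintro ⟨a, ha, -⟩
    rw [tendsto_smallSets_iff]
    intro t ht
    -- for small `η`, only the pairs of maximal ratio are within `η` of the maximum
    have hev : ∀ᶠ η in 𝓝[>] (0 : ℝ), ∀ p : A × A, ratio β g x p.1 p.2 < maxRatio β A g x →
        η < maxRatio β A g x - ratio β g x p.1 p.2 := by
      refine eventually_all.2 fun p => ?_
      by_cases hp : ratio β g x p.1 p.2 < maxRatio β A g x
      · filter_upwards [mem_nhdsWithin_of_mem_nhds (Iio_mem_nhds (sub_pos.2 hp))] with η hη _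
        exact hη
      · exact Eventually.of_forall fun η h => absurd h hp
    filter_upwards [hev] with η hη
    rintro z ⟨u, hu, v, hv, hlt, rfl⟩
    have heq : ratio β g x u v = maxRatio β A g x := by
      refine (ratio_le_maxRatio hu hv).antisymm (not_lt.1 fun h => ?_)
      have := hη (⟨u, hu⟩, ⟨v, hv⟩) h
      simp only at this
      linarith
    rw [interp, heq, ← (envelope_eq_of_ratio_eq hβ hu hv heq).1]
    exact mem_of_mem_nhds ht
  · intro h u hu
    obtain ⟨a, ha, b, hb, hab⟩ := exists_ratio_eq_maxRatio ⟨u, hu⟩ β g x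
    have h0 : maxRatio β A g x = 0 := by rw [← hab, ratio, h a ha b hb]; simp
    have := (envelope_eq_of_ratio_eq hβ ha hb hab).1
    rw [this, h0, h a ha u hu]
    ring

theorem measurable_envelope [MeasurableSpace Ω] [BorelSpace Ω] [Finite A] (hβ : 0 < β) :
    Measurable (envelope β A g) := by
  have hpow : ∀ w : Ω, Measurable fun x : Ω => dist x w ^ β := fun w =>
    ((continuous_id.dist continuous_const).rpow_const fun _ => .inr hβ.le).measurable
  have hR : Measurable (maxRatio β A g) :=
    Measurable.iSup fun p : A × A => measurable_const.div ((hpow _).add (hpow _))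
  exact Measurable.iInf fun w : A => measurable_const.add (hR.mul (hpow _))

theorem rpow_dist_triangle (hβ : 0 < β) (hβ1 : β ≤ 1) (x y z : Ω) :
    dist x z ^ β ≤ dist x y ^ β + dist y z ^ β :=
  (Real.rpow_le_rpow dist_nonneg (dist_triangle x y z) hβ.le).trans
    (Real.rpow_add_le_add_rpow dist_nonneg dist_nonneg hβ.le hβ1)

/-- The envelope does not increase the slope at the points of `A`. -/
theorem abs_envelope_sub_le [Finite A] (hβ : 0 < β) (hβ1 : β ≤ 1) {j : Ω} (hj : j ∈ A) {s : ℝ}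
    (hs0 : 0 ≤ s) (hs : ∀ w ∈ A, |g j - g w| ≤ s * dist j w ^ β) (x : Ω) :
    |envelope β A g x - g j| ≤ s * dist x j ^ β := by
  have hpos : ∀ w : Ω, 0 ≤ dist x w ^ β := fun w => Real.rpow_nonneg dist_nonneg β
  rcases le_or_gt (maxRatio β A g x) s with hR | hR
  · have h1 := envelope_sub_le (β := β) (g := g) (x := x) hj
    have h2 := sub_envelope_le (β := β) (g := g) (x := x) hβ hj
    have := mul_le_mul_of_nonneg_right hR (hpos j)
    rw [abs_le]
    constructor <;> linarith
  · obtain ⟨u, hu, v, hv, h⟩ := exists_ratio_eq_maxRatio ⟨j, hj⟩ β g x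
    obtain ⟨h1, h2⟩ := envelope_eq_of_ratio_eq hβ hu hv h
    have key : ∀ w ∈ A, |g j - g w| - maxRatio β A g x * dist x w ^ β ≤ s * dist x j ^ β := by
      intro w hw
      have htri := rpow_dist_triangle hβ hβ1 j x w
      rw [dist_comm j x] at htri
      have := mul_le_mul_of_nonneg_left htri hs0
      have := mul_le_mul_of_nonneg_right hR.le (hpos w)
      linarith [hs w hw]
    have ku := key u hu
    have kv := key v hv
    rw [abs_le]
    constructor
    · linarith [le_abs_self (g j - g u)]
    · linarith [neg_abs_le (g j - g v)]

/-- Let `z` be a point at which `f` has slope at most `s`, and `j` a point of a `t`-packing `A` with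
`ρ(z, j) ≤ t`. The slope of `f` at `j` relative to `A` is at most `3 s`: seen from distance at least
`t`, replacing `j` by `z` changes little. Hence the envelope of `f|_A` is close to `f` near `z`. -/
theorem abs_envelope_sub_le_of_net [Finite A] (hβ : 0 < β) (hβ1 : β ≤ 1) {f : Ω → ℝ} {j z : Ω}
    (hj : j ∈ A) {s t : ℝ} (hs : 0 ≤ s) (ht : 0 ≤ t) (hz : ∀ y, |f z - f y| ≤ s * dist z y ^ β)
    (hgf : ∀ w ∈ A, g w = f w) (hpack : ∀ w ∈ A, w ≠ j → t ≤ dist j w) (hzj : dist z j ≤ t) (x : Ω) :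
    |envelope β A g x - f x| ≤ 4 * s * (dist z x ^ β + t ^ β) := by
  have htz : dist z j ^ β ≤ t ^ β := Real.rpow_le_rpow dist_nonneg hzj hβ.le
  have hslope : ∀ w ∈ A, |g j - g w| ≤ 3 * s * dist j w ^ β := by
    intro w hw
    rcases eq_or_ne w j with rfl | hne
    · simp [Real.zero_rpow hβ.ne']
    · have htw : t ^ β ≤ dist j w ^ β := Real.rpow_le_rpow ht (hpack w hw hne) hβ.le
      have htri := rpow_dist_triangle hβ hβ1 z j w
      have habs : |g j - g w| ≤ |f z - f j| + |f z - f w| := by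
        rw [hgf j hj, hgf w hw, abs_sub_comm (f z) (f j)]
        exact abs_sub_le _ _ _
      calc |g j - g w| ≤ s * dist z j ^ β + s * dist z w ^ β := by
            linarith [hz j, hz w]
        _ = s * (dist z j ^ β + dist z w ^ β) := by ring
        _ ≤ s * (3 * dist j w ^ β) := by
            refine mul_le_mul_of_nonneg_left ?_ hs
            linarith
        _ = 3 * s * dist j w ^ β := by ring
  have h1 := abs_envelope_sub_le hβ hβ1 hj (by positivity) hslope x
  have htri := rpow_dist_triangle hβ hβ1 x z j
  rw [dist_comm x z] at htri
  have h2 : |envelope β A g x - g j| ≤ 3 * s * (dist z x ^ β + t ^ β) :=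
    h1.trans (mul_le_mul_of_nonneg_left (by linarith) (by positivity))
  have h3 : |f z - f j| ≤ s * t ^ β := (hz j).trans (mul_le_mul_of_nonneg_left htz hs)
  have h4 := hz x
  rw [hgf j hj] at h2
  rw [abs_le] at *
  constructor <;> linarith [h2.1, h2.2, h3.1, h3.2, h4.1, h4.2]

end PMSE

/-! ### The hypothesis constructed by the learner -/

section Trimming

variable {n : ℕ} {s : ℕ → ℝ}

namespace RealRAM

theorem Before.trans {i j k : ℕ} (h : Before s i j) (h' : Before s j k) : Before s i k := by
  obtain ⟨h1, h2⟩ := h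
  obtain ⟨h3, h4⟩ := h'
  refine ⟨h3.trans h1, fun ⟨h5, h6⟩ => ?_⟩
  have hij : i < j := not_le.1 fun h => h2 ⟨h5.trans h3, h⟩
  have hjk : j < k := not_le.1 fun h => h4 ⟨h1.trans h5, h⟩
  omega

theorem Before.irrefl (i : ℕ) : ¬ Before s i i := fun h => h.2 ⟨le_rfl, le_rfl⟩

theorem before_or_before {i j : ℕ} (h : i ≠ j) : Before s i j ∨ Before s j i := by
  by_cases hij : s j ≤ s i <;> by_cases hji : s i ≤ s j
  · rcases h.lt_or_gt with h | h
    · exact .inl ⟨hij, fun h' => by omega⟩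
    · exact .inr ⟨hji, fun h' => by omega⟩
  · exact .inl ⟨hij, fun h' => hji h'.1⟩
  · exact .inr ⟨hji, fun h' => hij h'.1⟩
  · exact absurd (le_total (s j) (s i)) (by simp [hij, hji])

theorem rankBelow_lt_rankBelow {i j : ℕ} (hi : i < n) (h : Before s i j) :
    rankBelow s i n < rankBelow s j n := by
  classical
  simp only [rankBelow, Nat.count_eq_card_filter_range]
  refine Finset.card_lt_card ⟨fun a ha => ?_, fun hsub => ?_⟩
  · simp only [Finset.mem_filter] at ha ⊢
    exact ⟨ha.1, ha.2.trans h⟩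
  · have : i ∈ (Finset.range n).filter fun a => Before s a i := hsub (by simp [hi, h])
    exact Before.irrefl i (Finset.mem_filter.1 this).2

theorem rankBelow_lt {i : ℕ} (hi : i < n) : rankBelow s i n < n := by
  classical
  simp only [rankBelow, Nat.count_eq_card_filter_range]
  refine (Finset.card_lt_card ⟨Finset.filter_subset _ _, fun hsub => ?_⟩).trans_eq
    (Finset.card_range n)
  exact Before.irrefl i (Finset.mem_filter.1 (hsub (Finset.mem_range.2 hi))).2

/-- The ranks are a permutation of `0, …, n - 1`, so exactly `K` of them are below `K ≤ n`. -/
theorem card_rankBelow_lt {K : ℕ} (hK : K ≤ n) :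
    (Finset.univ.filter fun i : Fin n => rankBelow s i n < K).card = K := by
  classical
  have hinj : Function.Injective fun i : Fin n => rankBelow s i n := by
    intro i j hij
    by_contra hne
    have hne' : (i : ℕ) ≠ j := fun h => hne (Fin.ext h)
    rcases before_or_before (s := s) hne' with h | h
    · exact (rankBelow_lt_rankBelow i.2 h).ne hij
    · exact (rankBelow_lt_rankBelow j.2 h).ne' hij
  have himage : Finset.univ.image (fun i : Fin n => rankBelow s i n) = Finset.range n := by
    refine Finset.eq_of_subset_of_card_le (fun r hr => ?_) ?_
    · obtain ⟨i, -, rfl⟩ := Finset.mem_image.1 hr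
      exact Finset.mem_range.2 (rankBelow_lt i.2)
    · rw [Finset.card_image_of_injective _ hinj]; simp
  have hfilter : (Finset.range n).filter (· < K) = Finset.range K := by
    ext r; simp only [Finset.mem_filter, Finset.mem_range]; omega
  calc (Finset.univ.filter fun i : Fin n => rankBelow s i n < K).card
      = ((Finset.univ.filter fun i : Fin n => rankBelow s i n < K).image
          fun i : Fin n => rankBelow s i n).card := (Finset.card_image_of_injective _ hinj).symm
    _ = (Finset.range K).card := by rw [← hfilter, ← himage, Finset.filter_image]
    _ = K := Finset.card_range K

theorem isTrimmed_rankBelow {Ω : Type*} [MetricSpace Ω] {β γ : ℝ} (hγ0 : 0 < γ) (hγ1 : γ ≤ 1)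
    {S : Fin n → Ω × I} (hs : ∀ i : Fin n, s i = sampleSlope β S i) :
    IsTrimmed β γ S
      (Finset.univ.filter fun i : Fin n => ((rankBelow s i n + 1 : ℕ) : ℝ) ≤ γ * n) := by
  have hγn : 0 ≤ γ * n := by positivity
  have hiff : ∀ i : Fin n, ((rankBelow s i n + 1 : ℕ) : ℝ) ≤ γ * n ↔
      rankBelow s i n < ⌊γ * n⌋₊ := by
    intro i
    rw [← Nat.le_floor_iff hγn, Nat.succ_le_iff]
  simp only [hiff]
  refine ⟨card_rankBelow_lt ?_, fun i hi j hj => ?_⟩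
  · refine Nat.floor_le_of_le ?_
    nlinarith [(Nat.cast_nonneg n : (0 : ℝ) ≤ n)]
  · simp only [Finset.mem_filter, Finset.mem_univ, true_and, not_lt] at hi hj
    rw [← hs, ← hs]
    by_contra hlt
    have hB : Before s j i := ⟨(not_le.1 hlt).le, fun h => hlt h.1⟩
    exact absurd (rankBelow_lt_rankBelow j.2 hB) (by omega)

end RealRAM

end Trimming

section Hypothesis

variable {Ω : Type*} {n : ℕ}

/-- The sample points with index in `A`. -/
def netPoints (S : Fin n → Ω × I) (A : Finset (Fin n)) : Set Ω :=
  {x | ∃ i ∈ A, x = (S i).1}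

instance (S : Fin n → Ω × I) (A : Finset (Fin n)) : Finite (netPoints S A) := by
  have : netPoints S A = (fun i => (S i).1) '' (A : Set (Fin n)) := by
    ext x; simp [netPoints, eq_comm]
  rw [this]
  exact Set.Finite.to_subtype (A.finite_toSet.image _)

open Classical in
/-- The labels as a function of the sample points with index in `A`, extended by `0`. -/
noncomputable def labelOn (S : Fin n → Ω × I) (A : Finset (Fin n)) (x : Ω) : ℝ :=
  if h : ∃ i ∈ A, x = (S i).1 then ((S h.choose).2 : ℝ) else 0

theorem labelOn_mem_Icc (S : Fin n → Ω × I) (A : Finset (Fin n)) (x : Ω) :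
    labelOn S A x ∈ Set.Icc (0 : ℝ) 1 := by
  unfold labelOn
  split
  · exact Subtype.mem _
  · simp

theorem netPoints_nonempty {S : Fin n → Ω × I} {A : Finset (Fin n)} (hA : A.Nonempty) :
    (netPoints S A).Nonempty := by
  obtain ⟨i, hi⟩ := hA
  exact ⟨_, i, hi, rfl⟩

variable [MetricSpace Ω]

open Classical in
/-- The hypothesis built on the net `A`. -/
noncomputable def netHypothesis (β : ℝ) (S : Fin n → Ω × I) (A : Finset (Fin n)) (x : Ω) : ℝ :=
  if A = ∅ then 1 / 2 else PMSE.envelope β (netPoints S A) (labelOn S A) x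

theorem labelOn_apply {S : Fin n → Ω × I} {A : Finset (Fin n)} {t : ℝ} (ht : 0 < t)
    (hA : ∀ i ∈ A, ∀ j ∈ A, i ≠ j → t ≤ dist (S i).1 (S j).1) {i : Fin n} (hi : i ∈ A) :
    labelOn S A (S i).1 = (S i).2 := by
  have h : ∃ j ∈ A, (S i).1 = (S j).1 := ⟨i, hi, rfl⟩
  rw [labelOn, dif_pos h]
  by_contra hne
  have hij : i ≠ h.choose := fun heq => hne (by rw [← heq])
  exact absurd ((hA i hi _ h.choose_spec.1 hij).trans_eq (dist_eq_zero.2 h.choose_spec.2))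
    (not_le.2 ht)

theorem netHypothesis_mem_Icc {β : ℝ} (hβ : 0 < β) (S : Fin n → Ω × I) (A : Finset (Fin n))
    (x : Ω) : netHypothesis β S A x ∈ Set.Icc (0 : ℝ) 1 := by
  unfold netHypothesis
  split
  · constructor <;> norm_num
  · next h =>
    exact PMSE.envelope_mem_Icc hβ (netPoints_nonempty (Finset.nonempty_iff_ne_empty.2 h))
      fun w _ => labelOn_mem_Icc S A w

theorem measurable_netHypothesis [MeasurableSpace Ω] [BorelSpace Ω] {β : ℝ} (hβ : 0 < β)
    (S : Fin n → Ω × I) (A : Finset (Fin n)) : Measurable (netHypothesis β S A) := by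
  unfold netHypothesis
  split
  · exact measurable_const
  · exact PMSE.measurable_envelope hβ

theorem isTrimNetExtension_netHypothesis {β γ : ℝ} (hβ : 0 < β) (hγ : 0 < γ) {S : Fin n → Ω × I}
    {T A : Finset (Fin n)} (hT : IsTrimmed β γ S T) (hA : IsSampleNet (γ ^ (1 / β)) S Tᶜ A) :
    IsTrimNetExtension β γ S (netHypothesis β S A) := by
  refine ⟨T, A, hT, hA, fun hne => ⟨labelOn S A, fun i hi => ?_, ?_⟩, fun h x => ?_⟩
  · exact labelOn_apply (Real.rpow_pos_of_pos hγ _) hA.2.1 hi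
  · have h : netHypothesis β S A = PMSE.envelope β (netPoints S A) (labelOn S A) := by
      funext x
      rw [netHypothesis, if_neg hne.ne_empty]
    rw [h]
    exact PMSE.isExtension_envelope (A := netPoints S A) hβ
  · rw [netHypothesis, if_pos h]

end Hypothesis

namespace RealRAM

section Environment

variable {Ω : Type*} [MetricSpace Ω] {n : ℕ}

theorem sampleEnv_label (S : Fin n → Ω × I) (q : Option Ω) (i : Fin n) :
    (sampleEnv S q).label i = (S i).2 := by
  simp [sampleEnv]

theorem sampleEnv_distance (S : Fin n → Ω × I) (q : Option Ω) (i j : Fin n) :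
    (sampleEnv S q).distance i j = dist (S i).1 (S j).1 := by
  simp [sampleEnv, pointAt]

theorem sampleEnv_distance_query (S : Fin n → Ω × I) (x : Ω) (j : Fin n) :
    (sampleEnv S (some x)).distance n j = dist x (S j).1 := by
  simp [sampleEnv, pointAt]

theorem eq_sampleSlope_of_isGreatest {S : Fin n → Ω × I} {q : Option Ω} {β : ℝ} {i : Fin n} {v : ℝ}
    (h : IsGreatest (slopeSet (sampleEnv S q) β i n) v) : v = sampleSlope β S i := by
  refine le_antisymm ?_ (Real.iSup_le (fun j => h.2 (.inr ⟨j, j.1.2, ?_, ?_⟩)) (h.2 (.inl rfl)))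
  · rcases h.1 with h0 | ⟨j, hj, hd, hv⟩
    · rw [h0]
      exact Real.iSup_nonneg fun j => by positivity
    · have hd' := hd
      rw [sampleEnv_distance S q i ⟨j, hj⟩, dist_pos] at hd'
      rw [hv, sampleEnv_label, sampleEnv_distance S q i ⟨j, hj⟩, sampleEnv_label S q ⟨j, hj⟩]
      exact le_ciSup (f := fun j : {j : Fin n // (S j).1 ≠ (S i).1} =>
        |((S i).2 : ℝ) - (S j).2| / dist (S i).1 (S j).1 ^ β)
        (Set.finite_range _).bddAbove ⟨⟨j, hj⟩, hd'.symm⟩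
  · rw [sampleEnv_distance]; exact dist_pos.2 j.2.symm
  · rw [sampleEnv_distance, sampleEnv_label, sampleEnv_label]

open Classical in
/-- The prediction computed from the flags of a net is the value of the hypothesis built on it. -/
theorem prediction_eq_netHypothesis {S : Fin n → Ω × I} {β t : ℝ} (hβ : 0 < β) (ht : 0 < t)
    {f : ℕ → ℝ} {A : Finset (Fin n)} (hAf : ∀ i : Fin n, i ∈ A ↔ f i = 1)
    (hA : ∀ i ∈ A, ∀ j ∈ A, i ≠ j → t ≤ dist (S i).1 (S j).1) {x : Ω} {R v : ℝ}
    (hR : IsGreatest (ratioSet (sampleEnv S (some x)) β n f fun a b => a < n ∧ b < n) R)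
    (hv : IsLeast (valueSet (sampleEnv S (some x)) β R n f n) v) :
    (if 2 ≤ v then 1 / 2 else v) = netHypothesis β S A x := by
  have hlab : ∀ i ∈ A, labelOn S A (S i).1 = (S i).2 := fun i hi => labelOn_apply ht hA hi
  have hratio : ∀ i ∈ A, ∀ j ∈ A, envRatio (sampleEnv S (some x)) β n i j =
      PMSE.ratio β (labelOn S A) x (S i).1 (S j).1 := by
    intro i hi j hj
    rw [envRatio, PMSE.ratio, sampleEnv_label, sampleEnv_label, sampleEnv_distance_query,
      sampleEnv_distance_query, hlab i hi, hlab j hj]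
  rcases A.eq_empty_or_nonempty with rfl | hne
  · rw [netHypothesis, if_pos rfl, if_pos]
    rcases hv.1 with h | ⟨a, ha, hfa, -⟩
    · exact h.ge
    · exact absurd ((hAf ⟨a, ha⟩).2 hfa) (by simp)
  · have hpts := netPoints_nonempty (S := S) hne
    have hRmax : R = PMSE.maxRatio β (netPoints S A) (labelOn S A) x := by
      refine le_antisymm ?_ ?_
      · rcases hR.1 with h | ⟨a, b, ⟨ha, hb⟩, hfa, hfb, h⟩
        · rw [h]
          exact PMSE.maxRatio_nonneg hpts
        · have hiA := (hAf ⟨a, ha⟩).2 hfa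
          have hjA := (hAf ⟨b, hb⟩).2 hfb
          rw [h, hratio _ hiA _ hjA]
          exact PMSE.ratio_le_maxRatio ⟨_, hiA, rfl⟩ ⟨_, hjA, rfl⟩
      · obtain ⟨_, ⟨i, hi, rfl⟩, _, ⟨j, hj, rfl⟩, h⟩ :=
          PMSE.exists_ratio_eq_maxRatio hpts β (labelOn S A) x
        rw [← h, ← hratio i hi j hj]
        exact hR.2 (.inr ⟨i, j, ⟨i.2, j.2⟩, (hAf i).1 hi, (hAf j).1 hj, rfl⟩)
    have hval : ∀ i ∈ A, (sampleEnv S (some x)).label i +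
        R * (sampleEnv S (some x)).distance n i ^ β =
        labelOn S A (S i).1 + PMSE.maxRatio β (netPoints S A) (labelOn S A) x *
          dist x (S i).1 ^ β := by
      intro i hi
      rw [sampleEnv_label, sampleEnv_distance_query, hlab i hi, hRmax]
    have hmem := netHypothesis_mem_Icc hβ S A x
    rw [netHypothesis, if_neg hne.ne_empty] at hmem ⊢
    have hle : v ≤ PMSE.envelope β (netPoints S A) (labelOn S A) x := by
      have : Nonempty (netPoints S A) := hpts.to_subtype
      refine le_ciInf fun w => ?_
      obtain ⟨_, i, hi, rfl⟩ := w
      rw [← hval i hi]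
      exact hv.2 (.inr ⟨i, i.2, (hAf i).1 hi, rfl⟩)
    have hlt : ¬ 2 ≤ v := by linarith [hmem.2]
    rw [if_neg hlt]
    refine hle.antisymm ?_
    rcases hv.1 with h | ⟨a, ha, hfa, h⟩
    · exact absurd h.ge hlt
    · have hiA := (hAf ⟨a, ha⟩).2 hfa
      rw [h, hval _ hiA]
      exact ciInf_le (f := fun w : netPoints S A => labelOn S A w +
        PMSE.maxRatio β (netPoints S A) (labelOn S A) x * dist x w ^ β)
        (Set.finite_range _).bddBelow ⟨_, _, hiA, rfl⟩

/-- Training and prediction take at most `400 (n + 1) ^ 2` steps. -/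
noncomputable def timeBound : Polynomial ℕ := 400 * (Polynomial.X + 1) ^ 2

theorem le_timeBound_eval {n a b c : ℕ} (ha : a ≤ 400) (hb : b ≤ 400) (hc : c ≤ 400) :
    n * (n * a + b) + c ≤ timeBound.eval n := by
  have h : timeBound.eval n = 400 * (n + 1) ^ 2 := by simp [timeBound]
  have h1 : n * n * a ≤ n * n * 400 := Nat.mul_le_mul_left _ ha
  have h2 : n * b ≤ n * 400 := Nat.mul_le_mul_left _ hb
  rw [h]
  nlinarith

/-- On every sample the learner trims, takes a net and constructs the hypothesis built on it. -/
theorem exists_constructs {β L ε : ℝ} (hβ : 0 < β) (hγ0 : 0 < trimLevel ε L)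
    (hγ1 : trimLevel ε L ≤ 1) (S : Fin n → Ω × I) :
    ∃ T A : Finset (Fin n), IsTrimmed β (trimLevel ε L) S T ∧
      IsSampleNet (trimLevel ε L ^ (1 / β)) S Tᶜ A ∧
      trimNetExtend.Constructs β L ε S (netHypothesis β S A) (timeBound.eval n) := by
  classical
  obtain ⟨t, ht, m, hrun, h0, hp, h4, s, hs, hnet⟩ :=
    train_halts (sampleEnv S none) (β := β) (L := L) (ε := ε) (n := n)
  have hslope : ∀ i : Fin n, s i = sampleSlope β S i := fun i =>
    eq_sampleSlope_of_isGreatest (hs i i.2)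
  set A : Finset (Fin n) := Finset.univ.filter fun i : Fin n => m.cell 2 i = 1 with hAdef
  have hAf : ∀ i : Fin n, i ∈ A ↔ m.cell 2 i = 1 := fun i => by simp [hAdef]
  have hpack : ∀ i ∈ A, ∀ j ∈ A, i ≠ j →
      trimLevel ε L ^ (1 / β) ≤ dist (S i).1 (S j).1 := by
    intro i hi j hj hij
    rcases (Fin.val_ne_of_ne hij).lt_or_gt with h | h
    · have := hnet.packing j i h ((hAf j).1 hj) ((hAf i).1 hi)
      rwa [sampleEnv_distance, dist_comm] at this
    · have := hnet.packing i j h ((hAf i).1 hi) ((hAf j).1 hj)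
      rwa [sampleEnv_distance] at this
  refine ⟨_, A, isTrimmed_rankBelow hγ0 hγ1 hslope, ⟨fun i hi => ?_, hpack, fun i hi => ?_⟩, m,
    ⟨t, ht.trans ?_, hrun⟩, fun x => ?_⟩
  · have := (hnet.below i ((hAf i).1 hi)).2
    simpa using this
  · have hkept : ¬ ((rankBelow s i n + 1 : ℕ) : ℝ) ≤ trimLevel ε L * n := by simpa using hi
    rcases hnet.cover i i.2 hkept with h | ⟨j, hj, hd⟩
    · exact ⟨i, (hAf i).2 h, by simpa using (Real.rpow_pos_of_pos hγ0 _).le⟩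
    · have hjn := (hnet.below j hj).1
      refine ⟨⟨j, hjn⟩, (hAf _).2 hj, ?_⟩
      have := sampleEnv_distance S none i ⟨j, hjn⟩
      rw [← this]
      exact hd.le
  · exact le_timeBound_eval (by norm_num) (by norm_num) (by norm_num)
  · obtain ⟨t', ht', m', hrun', R, v, hR, hv, hm'⟩ :=
      predict_halts (sampleEnv S (some x)) hnet.zero_or_one h0 hp rfl h4
    refine ⟨m', ⟨t', ht'.trans ?_, hrun'⟩, ?_⟩
    · exact le_timeBound_eval (by norm_num) (by norm_num) (by norm_num)
    · rw [hm']
      have hβ0 : (startMem β L ε n).cell 0 0 = β := by simp [startMem]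
      rw [hβ0] at hR hv
      exact prediction_eq_netHypothesis hβ (Real.rpow_pos_of_pos hγ0 (1 / β)) hAf hpack hR hv

end Environment

end RealRAM

/-! ### The slope function -/

section Slope

variable {Ω : Type*} [MetricSpace Ω] {β : ℝ} {f : Ω → ℝ}

theorem abs_sub_le_of_slopeAt_le (hβ : 0 < β) {x : Ω} {s : ℝ} (hs : 0 ≤ s)
    (h : slopeAt β f x ≤ ENNReal.ofReal s) (y : Ω) : |f x - f y| ≤ s * dist x y ^ β := by
  rcases eq_or_ne y x with rfl | hne
  · simp [Real.zero_rpow hβ.ne']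
  · have hpos : 0 < dist x y ^ β := Real.rpow_pos_of_pos (dist_pos.2 hne.symm) β
    have := (le_iSup₂ (f := fun (y : Ω) (_ : y ≠ x) =>
      ENNReal.ofReal (|f x - f y| / dist x y ^ β)) y hne).trans h
    rwa [ENNReal.ofReal_le_ofReal_iff hs, div_le_iff₀ hpos] at this

/-- A point of finite slope is a point of continuity. -/
theorem slopeAt_eq_top_of_not_continuousAt (hβ : 0 < β) {x : Ω} (h : ¬ ContinuousAt f x) :
    slopeAt β f x = ⊤ := by
  by_contra hne
  refine h ?_
  have hle : slopeAt β f x ≤ ENNReal.ofReal (slopeAt β f x).toReal := (ENNReal.ofReal_toReal hne).ge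
  have hb := abs_sub_le_of_slopeAt_le hβ ENNReal.toReal_nonneg hle
  have hlim : Tendsto (fun y => (slopeAt β f x).toReal * dist x y ^ β) (𝓝 x) (𝓝 0) := by
    have hcont : Continuous fun y => (slopeAt β f x).toReal * dist x y ^ β :=
      continuous_const.mul ((continuous_const.dist continuous_id).rpow_const fun _ => .inr hβ.le)
    simpa [Real.zero_rpow hβ.ne'] using hcont.tendsto x
  rw [ContinuousAt, tendsto_iff_dist_tendsto_zero]
  refine squeeze_zero (fun _ => dist_nonneg) (fun y => ?_) hlim
  rw [dist_comm, Real.dist_eq]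
  exact hb y

/-- A superlevel set of the slope is a neighbourhood of each of its points of continuity, and
contains all points of discontinuity, which form a Borel set. -/
theorem measurable_slopeAt [MeasurableSpace Ω] [BorelSpace Ω] (hβ : 0 < β) :
    Measurable (slopeAt β f) := by
  refine measurable_of_Ioi fun a => ?_
  rcases eq_or_ne a ⊤ with rfl | ha
  · simp
  have hset : slopeAt β f ⁻¹' Set.Ioi a =
      interior (slopeAt β f ⁻¹' Set.Ioi a) ∪ {x | ContinuousAt f x}ᶜ := by
    refine Set.Subset.antisymm (fun x hx => ?_) (Set.union_subset interior_subset fun x hx => ?_)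
    · by_cases hc : ContinuousAt f x
      · left
        obtain ⟨y, hy⟩ := lt_iSup_iff.1 (show a < slopeAt β f x from hx)
        obtain ⟨hne, hlt⟩ := lt_iSup_iff.1 hy
        have hcont : ContinuousAt
            (fun z => ENNReal.ofReal (|f z - f y| / dist z y ^ β)) x := by
          refine ENNReal.continuous_ofReal.continuousAt.comp ?_
          refine (hc.sub continuousAt_const).abs.div ?_ ?_
          · exact ((continuous_id.dist continuous_const).rpow_const
              fun _ => .inr hβ.le).continuousAt
          · exact (Real.rpow_pos_of_pos (dist_pos.2 hne.symm) β).ne'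
        rw [mem_interior_iff_mem_nhds]
        filter_upwards [hcont.eventually (lt_mem_nhds hlt),
          isOpen_ne.mem_nhds hne.symm] with z hz hzy
        exact lt_of_lt_of_le hz (le_iSup₂ (f := fun (w : Ω) (_ : w ≠ z) =>
          ENNReal.ofReal (|f z - f w| / dist z w ^ β)) y (Ne.symm hzy))
      · exact .inr hc
    · rw [Set.mem_preimage, slopeAt_eq_top_of_not_continuousAt hβ hx]
      exact lt_top_iff_ne_top.2 ha
  rw [hset]
  exact isOpen_interior.measurableSet.union
    (IsGδ.setOfPred_continuousAt f).measurableSet.compl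

end Slope

/-! ### Counting sample points -/

section Counting

variable {α : Type*} [MeasurableSpace α] {D : Measure α} [IsProbabilityMeasure D] {n : ℕ}

open Classical in
/-- A lower tail bound for the number of sample points in a set of mass at least `q`, from
`E 2 ^ (-count) = (1 - D(G) / 2) ^ n`. -/
theorem measureReal_card_le (G : Set α) (hG : MeasurableSet G) {q κ : ℝ} (hq : q ≤ D.real G)
    (hκ : κ ≤ q * n / 4) :
    (Measure.pi fun _ : Fin n => D).real
        {S | ((Finset.univ.filter fun i => S i ∈ G).card : ℝ) ≤ κ} ≤ Real.exp (-(n * q / 4)) := by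
  set F : α → ℝ := fun a => 1 - G.indicator (fun _ => 1 / 2) a with hF
  have hFin : ∀ a, F a = if a ∈ G then 1 / 2 else 1 := by
    intro a
    by_cases h : a ∈ G
    · simp [hF, h]; norm_num
    · simp [hF, h]
  have hFpos : ∀ a, 0 ≤ F a := fun a => by rw [hFin]; split <;> norm_num
  have hFle : ∀ a, F a ≤ 1 := fun a => by rw [hFin]; split <;> norm_num
  have hFm : Measurable F := measurable_const.sub (measurable_const.indicator hG)
  have hFint : ∫ a, F a ∂D = 1 - D.real G / 2 := by
    rw [hF, integral_sub (integrable_const _) ((integrable_const _).indicator hG),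
      integral_indicator hG]
    simp [div_eq_mul_inv]
  have hprod : ∀ S : Fin n → α, ∏ i, F (S i) =
      (1 / 2 : ℝ) ^ (Finset.univ.filter fun i => S i ∈ G).card := by
    intro S
    simp only [hFin, Finset.prod_ite, Finset.prod_const, one_pow, mul_one]
  have hint : Integrable (fun S : Fin n → α => ∏ i, F (S i)) (Measure.pi fun _ => D) := by
    refine Integrable.of_bound (C := 1) ?_ (Eventually.of_forall fun S => ?_)
    · exact (Finset.measurable_prod _ fun i _ =>
        hFm.comp (measurable_pi_apply i)).aestronglyMeasurable
    · rw [Real.norm_of_nonneg (Finset.prod_nonneg fun i _ => hFpos _)]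
      exact Finset.prod_le_one (fun i _ => hFpos _) fun i _ => hFle _
  have hmarkov := mul_meas_ge_le_integral_of_nonneg (μ := Measure.pi fun _ : Fin n => D)
    (Eventually.of_forall fun S => Finset.prod_nonneg fun i _ => hFpos _) hint
    ((1 / 2 : ℝ) ^ κ)
  rw [integral_fintype_prod_eq_prod (f := fun _ => F), Finset.prod_const, hFint,
    Finset.card_univ, Fintype.card_fin] at hmarkov
  have hsub : {S : Fin n → α | ((Finset.univ.filter fun i => S i ∈ G).card : ℝ) ≤ κ} ⊆
      {S | (1 / 2 : ℝ) ^ κ ≤ ∏ i, F (S i)} := by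
    intro S hS
    change (1 / 2 : ℝ) ^ κ ≤ ∏ i, F (S i)
    rw [hprod, ← Real.rpow_natCast]
    exact Real.rpow_le_rpow_of_exponent_ge (by norm_num) (by norm_num) hS
  have hhalf : Real.exp (-κ) ≤ (1 / 2 : ℝ) ^ κ ∨ κ < 0 := by
    rcases lt_or_ge κ 0 with h | h
    · exact .inr h
    · left
      rw [Real.rpow_def_of_pos (by norm_num), Real.exp_le_exp, one_div, Real.log_inv]
      nlinarith [Real.log_two_lt_d9]
  rcases hhalf with hhalf | hneg
  · have hpow : (1 - D.real G / 2) ^ n ≤ Real.exp (-(n * q / 2)) := by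
      have h1 : D.real G ≤ 1 := measureReal_le_one
      calc (1 - D.real G / 2) ^ n ≤ Real.exp (-(D.real G / 2)) ^ n := by
            refine pow_le_pow_left₀ (by linarith) ?_ n
            linarith [Real.add_one_le_exp (-(D.real G / 2))]
        _ = Real.exp (-(n * D.real G / 2)) := by rw [← Real.exp_nat_mul]; ring_nf
        _ ≤ Real.exp (-(n * q / 2)) := by
            rw [Real.exp_le_exp]
            have := mul_le_mul_of_nonneg_left hq (Nat.cast_nonneg (α := ℝ) n)
            linarith
    have hmono := measureReal_mono (μ := Measure.pi fun _ : Fin n => D) hsub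
    have h1 : Real.exp (-κ) * (Measure.pi fun _ : Fin n => D).real
        {S | ((Finset.univ.filter fun i => S i ∈ G).card : ℝ) ≤ κ} ≤ Real.exp (-(n * q / 2)) :=
      (mul_le_mul hhalf hmono measureReal_nonneg (by positivity)).trans (hmarkov.trans hpow)
    rw [← le_div_iff₀' (Real.exp_pos _), ← Real.exp_sub] at h1
    refine h1.trans ?_
    rw [Real.exp_le_exp]
    linarith
  · have : {S : Fin n → α | ((Finset.univ.filter fun i => S i ∈ G).card : ℝ) ≤ κ} = ∅ := by
      refine Set.eq_empty_of_forall_notMem fun S hS => ?_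
      have h0 : (0 : ℝ) ≤ (Finset.univ.filter fun i => S i ∈ G).card := Nat.cast_nonneg _
      exact absurd (h0.trans hS) (not_le.2 hneg)
    rw [this]
    simp [Real.exp_nonneg]

end Counting

/-! ### Partition into cells of small diameter -/

section Cells

variable {Ω : Type*} [MetricSpace Ω]

/-- A finite covering number provides a measurable partition into that many cells of diameter at
most `2 r`. -/
theorem exists_cells [MeasurableSpace Ω] [BorelSpace Ω] {r : ℝ} (hr : 0 ≤ r)
    (h : Metric.coveringNumber r.toNNReal (Set.univ : Set Ω) ≠ ⊤) :
    ∃ C : Fin (Metric.coveringNumber r.toNNReal (Set.univ : Set Ω)).toNat → Set Ω,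
      (∀ k, MeasurableSet (C k)) ∧ Pairwise (Function.onFun Disjoint C) ∧ (⋃ k, C k) = Set.univ ∧
      ∀ k, ∀ x ∈ C k, ∀ y ∈ C k, dist x y ≤ 2 * r := by
  obtain ⟨P, -, hfin, hcov, hcard⟩ := Metric.exists_set_encard_eq_coveringNumber h
  have hn : P.ncard = (Metric.coveringNumber r.toNNReal (Set.univ : Set Ω)).toNat := by
    rw [← hcard]; rfl
  rw [← hn]
  have := hfin.fintype
  have e : Fin P.ncard ≃ P := (Fintype.equivFinOfCardEq (by
    rw [← Nat.card_eq_fintype_card]; rfl)).symm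
  set B : Fin P.ncard → Set Ω := fun k => Metric.closedBall (e k : Ω) r with hB
  have hBm : ∀ k, MeasurableSet (B k) := fun k => Metric.isClosed_closedBall.measurableSet
  have hcover : ∀ x, ∃ k, x ∈ B k := by
    intro x
    obtain ⟨c, hc, hxc⟩ := hcov (Set.mem_univ x)
    refine ⟨e.symm ⟨c, hc⟩, ?_⟩
    have hd : edist x c ≤ (r.toNNReal : ℝ≥0∞) := hxc
    have : dist x c ≤ r := by
      rw [edist_dist] at hd
      exact (ENNReal.ofReal_le_ofReal_iff hr).1 hd
    simpa [hB] using this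
  refine ⟨fun k => B k \ ⋃ l, ⋃ (_ : l < k), B l, fun k => ?_, fun k l hkl => ?_, ?_, ?_⟩
  · exact (hBm k).diff (MeasurableSet.iUnion fun l => MeasurableSet.iUnion fun _ => hBm l)
  · refine Set.disjoint_left.2 fun x hx hx' => ?_
    rcases hkl.lt_or_gt with h | h
    · exact hx'.2 (Set.mem_iUnion₂.2 ⟨k, h, hx.1⟩)
    · exact hx.2 (Set.mem_iUnion₂.2 ⟨l, h, hx'.1⟩)
  · refine Set.eq_univ_of_forall fun x => ?_
    obtain ⟨k, hk, hmin⟩ := WellFounded.has_min (wellFounded_lt (α := Fin P.ncard))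
      {k | x ∈ B k} (hcover x)
    refine Set.mem_iUnion.2 ⟨k, hk, fun hx => ?_⟩
    obtain ⟨l, hl, hxl⟩ := Set.mem_iUnion₂.1 hx
    exact hmin l hxl hl
  · rintro k x ⟨hx, -⟩ y ⟨hy, -⟩
    rw [hB, Metric.mem_closedBall] at hx hy
    calc dist x y ≤ dist x (e k) + dist y (e k) := dist_triangle_right _ _ _
      _ ≤ 2 * r := by linarith

/-- Twice the average of `φ` over the set `C`. -/
noncomputable def twiceAverage {Ω : Type*} [MeasurableSpace Ω] (μ : Measure Ω) (φ : Ω → ℝ≥0∞)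
    (C : Set Ω) : ℝ≥0∞ :=
  2 * (∫⁻ x in C, φ x ∂μ) / μ C

/-- The points of `C` at which `φ` is at most twice its average over `C`. -/
def typicalPart {Ω : Type*} [MeasurableSpace Ω] (μ : Measure Ω) (φ : Ω → ℝ≥0∞)
    (C : Set Ω) : Set Ω :=
  C ∩ {x | φ x ≤ twiceAverage μ φ C}

theorem twiceAverage_mul_le {Ω : Type*} [MeasurableSpace Ω] (μ : Measure Ω) (φ : Ω → ℝ≥0∞)
    (C : Set Ω) : twiceAverage μ φ C * μ C ≤ 2 * ∫⁻ x in C, φ x ∂μ := by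
  rw [mul_comm]
  exact ENNReal.mul_div_le

/-- By Markov's inequality, the typical part of `C` has at least half of its mass. -/
theorem measure_le_two_mul_typicalPart {Ω : Type*} [MeasurableSpace Ω] {μ : Measure Ω}
    [IsFiniteMeasure μ] {φ : Ω → ℝ≥0∞} (hφ : Measurable φ) (hint : ∫⁻ x, φ x ∂μ ≠ ⊤) (C : Set Ω) :
    μ C ≤ 2 * μ (typicalPart μ φ C) := by
  set m := twiceAverage μ φ C with hm
  have hI : ∫⁻ x in C, φ x ∂μ ≠ ⊤ := ne_top_of_le_ne_top hint (setLIntegral_le_lintegral _ _)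
  have hmeas : MeasurableSet {x | m < φ x} := measurableSet_lt measurable_const hφ
  have hsplit : μ C = μ (typicalPart μ φ C) + μ (C ∩ {x | m < φ x}) := by
    rw [← measure_inter_add_sdiff C hmeas, add_comm]
    congr 2
    ext x
    simp [typicalPart, hm]
  have hbad : 2 * μ (C ∩ {x | m < φ x}) ≤ μ C := by
    by_cases hC0 : μ C = 0
    · rw [measure_mono_null Set.inter_subset_left hC0]; simp
    by_cases hI0 : ∫⁻ x in C, φ x ∂μ = 0
    · rw [lintegral_eq_zero_iff hφ] at hI0
      have : μ.restrict C {x | m < φ x} = 0 := by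
        refine measure_mono_null (fun x hx => ?_) hI0
        exact (lt_of_le_of_lt zero_le hx).ne'
      rw [Measure.restrict_apply hmeas, Set.inter_comm] at this
      rw [this]; simp
    · have hmar := mul_meas_ge_le_lintegral (μ := μ.restrict C) hφ m
      have hsub : μ (C ∩ {x | m < φ x}) ≤ μ.restrict C {x | m ≤ φ x} := by
        rw [Set.inter_comm, ← Measure.restrict_apply hmeas]
        exact measure_mono fun x (hx : m < φ x) => hx.le
      have h1 : m * μ (C ∩ {x | m < φ x}) ≤ ∫⁻ x in C, φ x ∂μ := (by gcongr : _ ≤ _).trans hmar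
      have h2 : m * μ C = 2 * ∫⁻ x in C, φ x ∂μ :=
        ENNReal.div_mul_cancel hC0 (measure_ne_top μ C)
      have hm0 : m ≠ 0 := fun h => by rw [h, zero_mul] at h2; simp [hI0] at h2
      have hmtop : m ≠ ⊤ := ENNReal.div_ne_top (ENNReal.mul_ne_top (by simp) hI) hC0
      rw [← ENNReal.mul_le_mul_iff_right hm0 hmtop, h2, mul_left_comm]
      gcongr
  have hfin : μ (C ∩ {x | m < φ x}) ≠ ⊤ := measure_ne_top _ _
  have hle : μ (C ∩ {x | m < φ x}) ≤ μ (typicalPart μ φ C) := by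
    rw [hsplit, two_mul] at hbad
    exact (ENNReal.add_le_add_iff_right hfin).1 hbad
  rw [hsplit, two_mul]
  gcongr

end Cells

/-! ### The risk of the hypothesis -/

section Risk

theorem risk_eq_lintegral {Ω : Type*} [MeasurableSpace Ω] {D : Measure (Ω × I)} {f h : Ω → ℝ} (hf : Measurable f)
    (hh : Measurable h) (hD : ∀ᵐ p ∂D, f p.1 = p.2) :
    risk D h = ∫⁻ x, ENNReal.ofReal |h x - f x| ∂(D.map Prod.fst) := by
  have hm : Measurable fun x => ENNReal.ofReal |h x - f x| :=
    ENNReal.measurable_ofReal.comp (measurable_norm.comp (hh.sub hf))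
  rw [lintegral_map hm measurable_fst]
  refine lintegral_congr_ae ?_
  filter_upwards [hD] with p hp
  rw [hp]

theorem ae_eq_of_risk_eq_zero {Ω : Type*} [MeasurableSpace Ω] {D : Measure (Ω × I)} {f : Ω → ℝ} (hf : Measurable f)
    (h : risk D f = 0) : ∀ᵐ p ∂D, f p.1 = p.2 := by
  have hm : Measurable fun p : Ω × I => ENNReal.ofReal |f p.1 - (p.2 : ℝ)| :=
    ((hf.comp measurable_fst).sub (measurable_subtype_coe.comp measurable_snd)).abs.ennreal_ofReal
  rw [risk, lintegral_eq_zero_iff hm] at h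
  filter_upwards [h] with p hp
  have h0 : |f p.1 - (p.2 : ℝ)| ≤ 0 := by simpa using hp
  exact sub_eq_zero.1 (abs_nonpos_iff.1 h0)

/-- The hypothesis is close to the target `f` on a cell with an untrimmed sample point of slope
at most `s`. -/
theorem abs_netHypothesis_sub_le {Ω : Type*} [MetricSpace Ω] {β γ τ s : ℝ} (hβ : 0 < β) (hβ1 : β ≤ 1) (hγ : 0 < γ)
    (hγτ : γ ≤ τ) (hs : 0 ≤ s) {f : Ω → ℝ} {n : ℕ} {S : Fin n → Ω × I} {B A : Finset (Fin n)}
    (hS : ∀ i, f (S i).1 = (S i).2) (hA : IsSampleNet (γ ^ (1 / β)) S B A) {i : Fin n} (hi : i ∈ B)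
    (hslope : slopeAt β f (S i).1 ≤ ENNReal.ofReal s) {x : Ω} (hx : dist (S i).1 x ^ β ≤ τ) :
    |netHypothesis β S A x - f x| ≤ 8 * s * τ := by
  obtain ⟨j, hj, hij⟩ := hA.2.2 i hi
  have ht : 0 < γ ^ (1 / β) := Real.rpow_pos_of_pos hγ _
  have htβ : (γ ^ (1 / β)) ^ β = γ := by
    rw [← Real.rpow_mul hγ.le, one_div_mul_cancel hβ.ne', Real.rpow_one]
  have hne : A ≠ ∅ := Finset.ne_empty_of_mem hj
  rw [netHypothesis, if_neg hne]
  have key := PMSE.abs_envelope_sub_le_of_net (A := netPoints S A) (g := labelOn S A) hβ hβ1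
    (f := f) (j := (S j).1) (z := (S i).1) ⟨j, hj, rfl⟩ hs ht.le
    (abs_sub_le_of_slopeAt_le hβ hs hslope) ?_ ?_ hij x
  · rw [htβ] at key
    have : 4 * s * (dist (S i).1 x ^ β + γ) ≤ 4 * s * (τ + τ) := by gcongr
    linarith
  · rintro _ ⟨w, hw, rfl⟩
    rw [labelOn_apply ht hA.2.1 hw, hS]
  · rintro _ ⟨w, hw, rfl⟩ hwj
    exact hA.2.1 j hj w hw fun h => hwj (by rw [h])

open Classical in
/-- The deterministic core of the risk bound: if every union of typical parts of cells of mass at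
least `ε / 4` contains more than `γ n` sample points, then the cells whose typical part holds no
untrimmed sample point have total mass at most `ε / 2`. On every other cell the error is at most
`8 τ` times twice the average slope. -/
theorem risk_netHypothesis_le {Ω : Type*} [MetricSpace Ω] [MeasurableSpace Ω] [BorelSpace Ω]
    {β γ τ L ε : ℝ} (hβ : 0 < β) (hβ1 : β ≤ 1) (hγ : 0 < γ)
    (hγτ : γ ≤ τ) (hε : 0 < ε) (hL : 0 ≤ L) {D : Measure (Ω × I)} [IsProbabilityMeasure D]
    {f : Ω → ℝ} (hf : Measurable f) (hf01 : ∀ x, f x ∈ Set.Icc (0 : ℝ) 1)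
    (hD : ∀ᵐ p ∂D, f p.1 = p.2)
    (hint : ∫⁻ x, slopeAt β f x ∂(D.map Prod.fst) ≤ ENNReal.ofReal L)
    {N : ℕ} {C : Fin N → Set Ω} (hCm : ∀ k, MeasurableSet (C k))
    (hCd : Pairwise (Function.onFun Disjoint C)) (hCu : ⋃ k, C k = Set.univ)
    (hCτ : ∀ k, ∀ x ∈ C k, ∀ y ∈ C k, dist x y ^ β ≤ τ)
    {n : ℕ} {S : Fin n → Ω × I} (hS : ∀ i, f (S i).1 = (S i).2) {T A : Finset (Fin n)}
    (hT : (T.card : ℝ) ≤ γ * n) (hA : IsSampleNet (γ ^ (1 / β)) S Tᶜ A)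
    (hgood : ∀ K : Finset (Fin N),
      ε / 4 ≤ (D.map Prod.fst).real
        (⋃ k ∈ K, typicalPart (D.map Prod.fst) (slopeAt β f) (C k)) →
      γ * n < (Finset.univ.filter fun i => (S i).1 ∈
        ⋃ k ∈ K, typicalPart (D.map Prod.fst) (slopeAt β f) (C k)).card) :
    risk D (netHypothesis β S A) ≤ ENNReal.ofReal (16 * τ * L + ε / 2) := by
  set μ := D.map Prod.fst with hμ
  have : IsProbabilityMeasure μ := Measure.isProbabilityMeasure_map measurable_fst.aemeasurable
  set φ := slopeAt β f with hφ
  have hφm : Measurable φ := measurable_slopeAt hβ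
  have hφint : ∫⁻ x, φ x ∂μ ≠ ⊤ := ne_top_of_le_ne_top ENNReal.ofReal_ne_top hint
  set h := netHypothesis β S A with hh
  have hhm : Measurable h := measurable_netHypothesis hβ S A
  rw [risk_eq_lintegral hf hhm hD, ← hμ]
  have hτ : 0 ≤ τ := (hγ.trans_le hγτ).le
  -- the cells whose typical part contains no untrimmed sample point
  set K : Finset (Fin N) := Finset.univ.filter fun k =>
    ∀ i, (S i).1 ∈ typicalPart μ φ (C k) → i ∈ T with hK
  have hHm : ∀ k, MeasurableSet (typicalPart μ φ (C k)) := fun k =>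
    (hCm k).inter (measurableSet_le hφm measurable_const)
  have hHd : Set.PairwiseDisjoint (K : Set (Fin N)) fun k => typicalPart μ φ (C k) :=
    fun k _ l _ hkl => (hCd hkl).mono Set.inter_subset_left Set.inter_subset_left
  have hmass : μ (⋃ k ∈ K, typicalPart μ φ (C k)) ≤ ENNReal.ofReal (ε / 4) := by
    have hlt : μ.real (⋃ k ∈ K, typicalPart μ φ (C k)) < ε / 4 := by
      by_contra hge
      refine absurd ((hgood K (not_lt.1 hge)).trans_le (le_trans ?_ hT)) (lt_irrefl _)
      refine Nat.cast_le.2 (Finset.card_le_card fun i hi => ?_)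
      obtain ⟨k, hk, hik⟩ := Set.mem_iUnion₂.1 (Finset.mem_filter.1 hi).2
      exact (Finset.mem_filter.1 hk).2 i hik
    rw [← ENNReal.ofReal_toReal (measure_ne_top μ (⋃ k ∈ K, typicalPart μ φ (C k)))]
    exact ENNReal.ofReal_le_ofReal hlt.le
  have hmissed : ∑ k ∈ K, μ (C k) ≤ ENNReal.ofReal (ε / 2) := by
    calc ∑ k ∈ K, μ (C k) ≤ ∑ k ∈ K, 2 * μ (typicalPart μ φ (C k)) :=
          Finset.sum_le_sum fun k _ => measure_le_two_mul_typicalPart hφm hφint (C k)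
      _ = 2 * μ (⋃ k ∈ K, typicalPart μ φ (C k)) := by
          rw [measure_biUnion_finset hHd fun k _ => hHm k, Finset.mul_sum]
      _ ≤ 2 * ENNReal.ofReal (ε / 4) := by gcongr
      _ = ENNReal.ofReal (ε / 2) := by
          rw [← ENNReal.ofReal_ofNat, ← ENNReal.ofReal_mul (by norm_num)]
          congr 1; ring
  have hsum : ∀ ψ : Ω → ℝ≥0∞, ∫⁻ x, ψ x ∂μ = ∑ k, ∫⁻ x in C k, ψ x ∂μ := by
    intro ψ
    rw [← setLIntegral_univ, ← hCu, lintegral_iUnion hCm hCd, tsum_fintype]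
  have hcell : ∀ k, ∫⁻ x in C k, ENNReal.ofReal |h x - f x| ∂μ ≤
      ENNReal.ofReal (16 * τ) * ∫⁻ x in C k, φ x ∂μ + if k ∈ K then μ (C k) else 0 := by
    intro k
    by_cases hk : k ∈ K
    · rw [if_pos hk]
      refine le_add_left ?_
      calc ∫⁻ x in C k, ENNReal.ofReal |h x - f x| ∂μ ≤ ∫⁻ _ in C k, 1 ∂μ := by
            refine lintegral_mono fun x => ?_
            rw [← ENNReal.ofReal_one]
            refine ENNReal.ofReal_le_ofReal ?_
            have h1 := netHypothesis_mem_Icc hβ S A x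
            have h2 := hf01 x
            rw [abs_le]
            constructor <;> linarith [h1.1, h1.2, h2.1, h2.2]
        _ = μ (C k) := by simp
    · rw [if_neg hk, add_zero]
      have hk' : ∃ i, (S i).1 ∈ typicalPart μ φ (C k) ∧ i ∉ T := by
        simpa [hK] using hk
      obtain ⟨i, hi, hiT⟩ := hk'
      by_cases hC0 : μ (C k) = 0
      · rw [setLIntegral_measure_zero _ _ hC0]; exact zero_le
      set m := twiceAverage μ φ (C k) with hm
      have hmtop : m ≠ ⊤ := ENNReal.div_ne_top (ENNReal.mul_ne_top (by simp)
        (ne_top_of_le_ne_top hφint (setLIntegral_le_lintegral _ _))) hC0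
      have hslope : slopeAt β f (S i).1 ≤ ENNReal.ofReal m.toReal := by
        rw [ENNReal.ofReal_toReal hmtop]; exact hi.2
      have herr : ∀ x ∈ C k, |h x - f x| ≤ 8 * m.toReal * τ := fun x hx =>
        abs_netHypothesis_sub_le hβ hβ1 hγ hγτ ENNReal.toReal_nonneg hS hA
          (Finset.mem_compl.2 hiT) hslope (hCτ k _ hi.1 _ hx)
      calc ∫⁻ x in C k, ENNReal.ofReal |h x - f x| ∂μ
          ≤ ∫⁻ _ in C k, ENNReal.ofReal (8 * m.toReal * τ) ∂μ :=
            setLIntegral_mono' (hCm k) fun x hx => ENNReal.ofReal_le_ofReal (herr x hx)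
        _ = ENNReal.ofReal (8 * τ) * (m * μ (C k)) := by
            rw [setLIntegral_const, ← mul_assoc]
            congr 1
            rw [show 8 * m.toReal * τ = 8 * τ * m.toReal by ring,
              ENNReal.ofReal_mul (by positivity), ENNReal.ofReal_toReal hmtop]
        _ ≤ ENNReal.ofReal (8 * τ) * (2 * ∫⁻ x in C k, φ x ∂μ) := by
            exact mul_le_mul_right (twiceAverage_mul_le μ φ (C k)) _
        _ = ENNReal.ofReal (16 * τ) * ∫⁻ x in C k, φ x ∂μ := by
            rw [← mul_assoc, ← ENNReal.ofReal_ofNat, ← ENNReal.ofReal_mul (by positivity)]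
            congr 2; ring
  rw [hsum]
  calc ∑ k, ∫⁻ x in C k, ENNReal.ofReal |h x - f x| ∂μ
      ≤ ∑ k, (ENNReal.ofReal (16 * τ) * ∫⁻ x in C k, φ x ∂μ + if k ∈ K then μ (C k) else 0) :=
        Finset.sum_le_sum fun k _ => hcell k
    _ = ENNReal.ofReal (16 * τ) * ∫⁻ x, φ x ∂μ + ∑ k ∈ K, μ (C k) := by
        rw [Finset.sum_add_distrib, ← Finset.mul_sum, ← hsum, Finset.sum_ite_mem,
          Finset.univ_inter]
    _ ≤ ENNReal.ofReal (16 * τ) * ENNReal.ofReal L + ENNReal.ofReal (ε / 2) := by gcongr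
    _ = ENNReal.ofReal (16 * τ * L + ε / 2) := by
        rw [← ENNReal.ofReal_mul (by positivity), ← ENNReal.ofReal_add (by positivity)
          (by positivity)]

open Classical in
/-- With probability at least `1 - 2 ^ N exp (-n ε / 16)`, all labels agree with the target and
every union of typical parts of mass at least `ε / 4` contains more than `γ n` sample points. -/
theorem measure_bad_sample_le {Ω : Type*} [MeasurableSpace Ω] {γ ε : ℝ} (hγε : γ ≤ ε / 16) {D : Measure (Ω × I)}
    [IsProbabilityMeasure D] {f : Ω → ℝ} (hD : ∀ᵐ p ∂D, f p.1 = p.2) {N : ℕ}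
    {H : Fin N → Set Ω} (hH : ∀ k, MeasurableSet (H k)) (n : ℕ) :
    (Measure.pi fun _ : Fin n => D)
      {S | ¬ ((∀ i, f (S i).1 = (S i).2) ∧ ∀ K : Finset (Fin N),
        ε / 4 ≤ (D.map Prod.fst).real (⋃ k ∈ K, H k) →
        γ * n < (Finset.univ.filter fun i => (S i).1 ∈ ⋃ k ∈ K, H k).card)} ≤
      ENNReal.ofReal (2 ^ N * Real.exp (-(n * ε / 16))) := by
  set P := Measure.pi fun _ : Fin n => D with hP
  set bad : Finset (Fin N) → Set (Fin n → Ω × I) := fun K =>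
    {S | ε / 4 ≤ (D.map Prod.fst).real (⋃ k ∈ K, H k) ∧
      ((Finset.univ.filter fun i => (S i).1 ∈ ⋃ k ∈ K, H k).card : ℝ) ≤ γ * n} with hbad
  have hlabels : P {S | ¬ ∀ i, f (S i).1 = (S i).2} = 0 := by
    have : ∀ᵐ S ∂P, ∀ i, f (S i).1 = (S i).2 :=
      ae_all_iff.2 fun i => (Measure.tendsto_eval_ae_ae (μ := fun _ : Fin n => D)
        (i := i)).eventually hD
    exact ae_iff.1 this
  have hK : ∀ K, P (bad K) ≤ ENNReal.ofReal (Real.exp (-(n * ε / 16))) := by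
    intro K
    by_cases hq : ε / 4 ≤ (D.map Prod.fst).real (⋃ k ∈ K, H k)
    · have hm : MeasurableSet (⋃ k ∈ K, H k) := K.measurableSet_biUnion fun k _ => hH k
      have hq' : ε / 4 ≤ D.real (Prod.fst ⁻¹' ⋃ k ∈ K, H k) := by
        rwa [map_measureReal_apply measurable_fst hm] at hq
      have hκ : γ * n ≤ ε / 4 * n / 4 := by
        have := mul_le_mul_of_nonneg_right hγε (Nat.cast_nonneg (α := ℝ) n)
        linarith
      have := measureReal_card_le (n := n) _ (measurable_fst hm) hq' hκ
      have hsub : bad K ⊆ {S | ((Finset.univ.filter fun i =>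
          S i ∈ Prod.fst ⁻¹' ⋃ k ∈ K, H k).card : ℝ) ≤ γ * n} := fun S hS => hS.2
      calc P (bad K) ≤ P {S | ((Finset.univ.filter fun i =>
            S i ∈ Prod.fst ⁻¹' ⋃ k ∈ K, H k).card : ℝ) ≤ γ * n} := measure_mono hsub
        _ = ENNReal.ofReal (P.real {S | ((Finset.univ.filter fun i =>
            S i ∈ Prod.fst ⁻¹' ⋃ k ∈ K, H k).card : ℝ) ≤ γ * n}) :=
            (ENNReal.ofReal_toReal (measure_ne_top _ _)).symm
        _ ≤ ENNReal.ofReal (Real.exp (-(n * ε / 16))) := by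
            refine ENNReal.ofReal_le_ofReal (this.trans_eq ?_)
            congr 1; ring
    · have : bad K = ∅ := Set.eq_empty_of_forall_notMem fun S hS => hq hS.1
      rw [this, measure_empty]; exact zero_le
  have hsub : {S : Fin n → Ω × I | ¬ ((∀ i, f (S i).1 = (S i).2) ∧ ∀ K : Finset (Fin N),
        ε / 4 ≤ (D.map Prod.fst).real (⋃ k ∈ K, H k) →
        γ * n < (Finset.univ.filter fun i => (S i).1 ∈ ⋃ k ∈ K, H k).card)} ⊆
      {S | ¬ ∀ i, f (S i).1 = (S i).2} ∪ ⋃ K, bad K := by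
    intro S hS
    by_cases h1 : ∀ i, f (S i).1 = (S i).2
    · right
      by_contra h2
      refine hS ⟨h1, fun K hq => ?_⟩
      by_contra h3
      exact h2 (Set.mem_iUnion.2 ⟨K, hq, not_lt.1 h3⟩)
    · exact .inl h1
  calc P _ ≤ P {S | ¬ ∀ i, f (S i).1 = (S i).2} + P (⋃ K, bad K) :=
        (measure_mono hsub).trans (measure_union_le _ _)
    _ ≤ 0 + ∑ K : Finset (Fin N), P (bad K) := by
        rw [hlabels]
        gcongr
        exact measure_iUnion_fintype_le P bad
    _ ≤ 0 + ∑ K : Finset (Fin N), ENNReal.ofReal (Real.exp (-(n * ε / 16))) := by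
        gcongr with K
        exact hK K
    _ = ENNReal.ofReal (2 ^ N * Real.exp (-(n * ε / 16))) := by
        rw [zero_add, Finset.sum_const, Finset.card_univ, Fintype.card_finset, Fintype.card_fin,
          nsmul_eq_mul, ENNReal.ofReal_mul (by positivity)]
        simp

end Risk

/-! ### Sample complexity -/

section SampleComplexity

theorem trimLevel_pos {ε L : ℝ} (hε : 0 < ε) (hεL : ε < L) : 0 < trimLevel ε L := by
  unfold trimLevel
  split
  · exact one_pos
  · have : 0 < L := hε.trans hεL
    positivity

theorem trimLevel_le_div {ε L : ℝ} (hε : 0 < ε) (hε2 : ε < 1 / 2) (hεL : ε < L) :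
    trimLevel ε L ≤ ε / 16 := by
  have hL : 0 < L := hε.trans hεL
  rw [trimLevel, if_neg (not_le.2 hε2), div_le_div_iff₀ (by positivity) (by norm_num)]
  nlinarith

theorem trimLevel_le_one {ε L : ℝ} (hε : 0 < ε) (hεL : ε < L) : trimLevel ε L ≤ 1 := by
  by_cases h : 1 / 2 ≤ ε
  · rw [trimLevel, if_pos h]
  · linarith [trimLevel_le_div hε (not_le.1 h) hεL]

/-- The trimming level is at most twice the `β`-th power of the covering radius, since
`log (1 / ε) ≤ 1 / ε`. -/
theorem trimLevel_le_two_mul {ε L : ℝ} (hε : 0 < ε) (hε2 : ε < 1 / 2) (hεL : ε < L) :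
    trimLevel ε L ≤ 2 * (ε / (256 * L * Real.log (1 / ε))) := by
  have hL : 0 < L := hε.trans hεL
  have hlog : 0 < Real.log (1 / ε) := Real.log_pos (by rw [lt_div_iff₀ hε]; linarith)
  have hle : Real.log (1 / ε) ≤ 1 / ε := by
    linarith [Real.log_le_sub_one_of_pos (show 0 < 1 / ε by positivity)]
  have h1 : ε * Real.log (1 / ε) ≤ 1 := by
    calc ε * Real.log (1 / ε) ≤ ε * (1 / ε) := by gcongr
      _ = 1 := mul_one_div_cancel hε.ne'
  rw [trimLevel, if_neg (not_le.2 hε2), mul_div_assoc', div_le_div_iff₀ (by positivity)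
    (by positivity)]
  have : 0 < ε * L := by positivity
  nlinarith

theorem complexityTerm_nonneg (Ω : Type*) [MetricSpace Ω] {β L ε δ : ℝ} (hε : 0 < ε) (hδ : 0 < δ)
    (hδ1 : δ < 1) : 0 ≤ complexityTerm Ω β L ε δ := by
  have : 0 ≤ Real.log (1 / δ) := Real.log_nonneg (by rw [le_div_iff₀ hδ]; linarith)
  unfold complexityTerm
  positivity

/-- A trimming level of `1` discards every sample point and leaves the constant hypothesis
`1 / 2`. -/
theorem risk_le_of_half_le {Ω : Type*} [MetricSpace Ω] [MeasurableSpace Ω] {β ε L t : ℝ}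
    (hε : 1 / 2 ≤ ε) {n : ℕ} {S : Fin n → Ω × I} {T A : Finset (Fin n)}
    (hT : IsTrimmed β (trimLevel ε L) S T) (hA : IsSampleNet t S Tᶜ A) (D : Measure (Ω × I))
    [IsProbabilityMeasure D] : risk D (netHypothesis β S A) ≤ ENNReal.ofReal ε := by
  have hTu : T = Finset.univ := by
    have := hT.1
    rw [trimLevel, if_pos hε, one_mul, Nat.floor_natCast] at this
    exact Finset.eq_univ_of_card T (by simpa using this)
  have hA0 : A = ∅ := by
    have := hA.1
    rw [hTu, Finset.compl_univ] at this
    exact Finset.subset_empty.1 this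
  calc risk D (netHypothesis β S A) ≤ ∫⁻ _, ENNReal.ofReal ε ∂D := by
        refine lintegral_mono fun p => ENNReal.ofReal_le_ofReal ?_
        rw [netHypothesis, if_pos hA0, abs_le]
        have := p.2.2
        constructor <;> linarith [this.1, this.2]
    _ = ENNReal.ofReal ε := by simp

/-- For `ε < 1 / 2`, the risk bound holds as soon as
`n ≥ 16 (N_Ω + log (1 / δ)) / ε`. -/
theorem measure_risk_gt_le {Ω : Type*} [MetricSpace Ω] [MeasurableSpace Ω] [BorelSpace Ω]
    {β L ε δ : ℝ} (hβ : 0 < β) (hβ1 : β ≤ 1) (hε : 0 < ε) (hε2 : ε < 1 / 2) (hεL : ε < L)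
    (hδ : 0 < δ)
    (hcov : Metric.coveringNumber ((ε / (256 * L * Real.log (1 / ε))) ^ (1 / β)).toNNReal
      (Set.univ : Set Ω) ≠ ⊤)
    (D : Measure (Ω × I)) [IsProbabilityMeasure D]
    (hD : Realizable D (avgHolder β L (D.map Prod.fst))) {n : ℕ}
    (hn : 16 * complexityTerm Ω β L ε δ ≤ n) {T A : (Fin n → Ω × I) → Finset (Fin n)}
    (hT : ∀ S, IsTrimmed β (trimLevel ε L) S (T S))
    (hA : ∀ S, IsSampleNet (trimLevel ε L ^ (1 / β)) S (T S)ᶜ (A S)) :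
    Measure.pi (fun _ : Fin n => D)
      {S | ¬ risk D (netHypothesis β S (A S)) ≤ ENNReal.ofReal ε} ≤ ENNReal.ofReal δ := by
  classical
  obtain ⟨f, ⟨hf01, hint⟩, hf, hrisk⟩ := hD
  have hL : 0 < L := hε.trans hεL
  have hlog2 : 1 / 4 ≤ Real.log (1 / ε) := by
    have h2 : Real.log 2 ≤ Real.log (1 / ε) :=
      Real.log_le_log (by norm_num) (by rw [le_div_iff₀ hε]; linarith)
    linarith [Real.log_two_gt_d9]
  set ρ := ε / (256 * L * Real.log (1 / ε)) with hρ
  have hρ0 : 0 < ρ := by positivity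
  have hr : 0 ≤ ρ ^ (1 / β) := (Real.rpow_pos_of_pos hρ0 _).le
  obtain ⟨C, hCm, hCd, hCu, hCr⟩ := exists_cells hr hcov
  have hCτ : ∀ k, ∀ x ∈ C k, ∀ y ∈ C k, dist x y ^ β ≤ 2 * ρ := by
    intro k x hx y hy
    have hpow : (ρ ^ (1 / β)) ^ β = ρ := by
      rw [← Real.rpow_mul hρ0.le, one_div_mul_cancel hβ.ne', Real.rpow_one]
    calc dist x y ^ β ≤ (2 * ρ ^ (1 / β)) ^ β :=
          Real.rpow_le_rpow dist_nonneg (hCr k x hx y hy) hβ.le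
      _ = 2 ^ β * ρ := by rw [Real.mul_rpow (by norm_num) hr, hpow]
      _ ≤ 2 * ρ := by
          gcongr
          simpa using Real.rpow_le_rpow_of_exponent_le (one_le_two (α := ℝ)) hβ1
  have hτL : 16 * (2 * ρ) * L + ε / 2 ≤ ε := by
    have : ρ * L * 256 * Real.log (1 / ε) = ε := by
      rw [hρ]; field_simp
    have h0 : 0 < ρ * L := by positivity
    nlinarith
  have hlabels := ae_eq_of_risk_eq_zero hf hrisk
  have hφm := measurable_slopeAt (f := f) hβ
  refine le_trans (measure_mono fun S hS => ?_) ((measure_bad_sample_le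
    (trimLevel_le_div hε hε2 hεL) hlabels (H := fun k =>
      typicalPart (D.map Prod.fst) (slopeAt β f) (C k))
    (fun k => (hCm k).inter (measurableSet_le hφm measurable_const)) n).trans ?_)
  · rintro ⟨hlab, hgood⟩
    refine hS ((risk_netHypothesis_le hβ hβ1 (trimLevel_pos hε hεL)
      (trimLevel_le_two_mul hε hε2 hεL) hε hL.le hf hf01 hlabels hint hCm hCd hCu hCτ hlab ?_ (hA S)
      hgood).trans (ENNReal.ofReal_le_ofReal hτL))
    rw [(hT S).1]
    have := (trimLevel_pos hε hεL).le
    exact Nat.floor_le (by positivity)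
  · refine ENNReal.ofReal_le_ofReal ?_
    rw [complexityTerm, mul_div_assoc', div_le_iff₀ hε] at hn
    set N := (Metric.coveringNumber (ρ ^ (1 / β)).toNNReal (Set.univ : Set Ω)).toNat
    have h2 : (2 : ℝ) ^ N ≤ Real.exp N := by
      rw [← Real.exp_one_pow]
      exact pow_le_pow_left₀ (by norm_num) (by linarith [Real.exp_one_gt_d9]) N
    calc (2 : ℝ) ^ N * Real.exp (-(n * ε / 16))
        ≤ Real.exp N * Real.exp (-(N + Real.log (1 / δ))) := by
          gcongr
          linarith
      _ = δ := by
          rw [← Real.exp_add, one_div, Real.log_inv,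
            show (N : ℝ) + -(N + -Real.log δ) = Real.log δ by ring, Real.exp_log hδ]

end SampleComplexity

theorem mainTheorem3 :
    -- one learner, one polynomial time bound, one trimming level `γ(ε, L)`, and universal
    -- constants `C, k` in the soft-O bound
    ∃ (𝒜 : RealRAM.Learner) (p : Polynomial ℕ) (γ : ℝ → ℝ → ℝ) (C : ℝ) (k : ℕ),
      ∀ (Ω : Type*) [MetricSpace Ω] [MeasurableSpace Ω] [BorelSpace Ω] (β L ε : ℝ),
        0 < β → β ≤ 1 → 0 < ε → ε < 1 → ε < L →
        (0 < γ ε L ∧ γ ε L ≤ 1) ∧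
        ∃ hyp : (n : ℕ) → (Fin n → Ω × I) → Ω → ℝ,
          (∀ (n : ℕ) (S : Fin n → Ω × I),
            𝒜.Constructs β L ε S (hyp n S) (p.eval n) ∧
            IsTrimNetExtension β (γ ε L) S (hyp n S) ∧
            Measurable (hyp n S) ∧ ∀ x, hyp n S x ∈ Set.Icc (0 : ℝ) 1) ∧
          (Metric.coveringNumber ((ε / (256 * L * Real.log (1 / ε))) ^ (1 / β)).toNNReal
              (Set.univ : Set Ω) ≠ ⊤ →
            ∀ δ : ℝ, 0 < δ → δ < 1 →
              ∃ N : ℕ,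
                (N : ℝ) ≤ C * complexityTerm Ω β L ε δ *
                  Real.log (Real.exp 1 + complexityTerm Ω β L ε δ) ^ k ∧
                ∀ (D : Measure (Ω × I)) [IsProbabilityMeasure D],
                  Realizable D (avgHolder β L (D.map Prod.fst)) →
                  ∀ n : ℕ, N ≤ n →
                    Measure.pi (fun _ : Fin n => D)
                      {S | ¬ risk D (hyp n S) ≤ ENNReal.ofReal ε} ≤ ENNReal.ofReal δ) := by
  -- no logarithmic factor is needed, so that `k = 0`
  refine ⟨RealRAM.trimNetExtend, RealRAM.timeBound, trimLevel, 17, 0, ?_⟩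
  intro Ω _ _ _ β L ε hβ hβ1 hε hε1 hεL
  have hγ0 := trimLevel_pos hε hεL
  have hγ1 := trimLevel_le_one hε hεL
  refine ⟨⟨hγ0, hγ1⟩, ?_⟩
  choose T A hT hA hcon using fun (n : ℕ) (S : Fin n → Ω × I) =>
    RealRAM.exists_constructs hβ hγ0 hγ1 S
  refine ⟨fun n S => netHypothesis β S (A n S), fun n S => ⟨hcon n S,
    isTrimNetExtension_netHypothesis hβ hγ0 (hT n S) (hA n S),
    measurable_netHypothesis hβ S _, netHypothesis_mem_Icc hβ S _⟩, ?_⟩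
  intro hcov δ hδ hδ1
  simp only [pow_zero, mul_one]
  have hM := complexityTerm_nonneg Ω (β := β) (L := L) hε hδ hδ1
  rcases le_or_gt (1 / 2) ε with hε2 | hε2
  · refine ⟨0, by simpa using hM, fun D _ _ n _ => ?_⟩
    have : {S : Fin n → Ω × I | ¬ risk D (netHypothesis β S (A n S)) ≤ ENNReal.ofReal ε} = ∅ :=
      Set.eq_empty_of_forall_notMem fun S hS =>
        hS (risk_le_of_half_le hε2 (hT n S) (hA n S) D)
    rw [this, measure_empty]
    exact zero_le
  · rcases isEmpty_or_nonempty Ω with hΩ | hΩ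
    · -- there is no probability measure on the empty space
      refine ⟨0, by simpa using hM, fun D _ _ n _ => ?_⟩
      obtain ⟨p, -⟩ := nonempty_of_isProbabilityMeasure D
      exact hΩ.elim p
    · refine ⟨⌈16 * complexityTerm Ω β L ε δ⌉₊, ?_, fun D _ hD n hn =>
        measure_risk_gt_le hβ hβ1 hε hε2 hεL hδ hcov D hD (Nat.ceil_le.1 hn) (hT n) (hA n)⟩
      -- rounding up costs at most one sample point, and the complexity term is at least `1`
      have hone : 1 ≤ complexityTerm Ω β L ε δ := by
        have hN : 1 ≤ (Metric.coveringNumber ((ε / (256 * L * Real.log (1 / ε))) ^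
            (1 / β)).toNNReal (Set.univ : Set Ω)).toNat := by
          rw [Nat.one_le_iff_ne_zero, Ne, ENat.toNat_eq_zero]
          exact not_or.2 ⟨fun h => Set.univ_nonempty.ne_empty (Metric.coveringNumber_eq_zero.1 h),
            hcov⟩
        have hlog : 0 ≤ Real.log (1 / δ) := Real.log_nonneg (by rw [le_div_iff₀ hδ]; linarith)
        rw [complexityTerm, le_div_iff₀ hε]
        have : (1 : ℝ) ≤ _ := Nat.one_le_cast.2 hN
        linarith
      linarith [Nat.ceil_lt_add_one (show 0 ≤ 16 * complexityTerm Ω β L ε δ by positivity)]
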